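/- Let $d \ge 1$, let $\mathcal A$ be a measurable space of actions, $\phi : \mathcal A \to \mathbb{R}^d$ a measurable feature map and $\theta^* \in \mathbb{R}^d$. In each round $t = 1, 2, \dots$ a learner observes an action set $\mathcal A_t \subseteq \mathcal A$ (which may be random), plays an action $a_t \in \mathcal A_t$ and receives the reward $r_t = \phi(a_t)^\top \theta^* + \epsilon_t$. Let $\Phi_t \in \mathbb{R}^{t \times d}$ be the matrix with rows $\phi(a_1)^\top, \dots, \phi(a_t)^\top$, let $\mathbf r_t = (r_1, \dots, r_t)^\top$, and let $\mathcal H_t$ be the $\sigma$-algebra generated by $a_1, r_1, \dots, a_t, r_t, a_{t+1}$. Let $\sigma, B, L, C > 0$ and assume that, for all $t \ge 1$, 1. $\mathbb{E}[\epsilon_t \mid \mathcal H_{t-1}] = 0$ and $\mathbb{E}[e^{\lambda \epsilon_t} \mid \mathcal H_{t-1}] \le e^{\lambda^2 \sigma^2 / 2}$ for all $\lambda \in \mathbb{R}$; 2. $\|\theta^*\|_2 \le B$; 3. $\|\phi(a)\|_2 \le L$ for all $a \in \mathcal A_t$; 4. $\phi(a)^\top \theta^* \in [-C, C]$ for all $a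 \in \mathcal A_t$. Let $c > 0$, $\delta \in (0, 1]$ and $\alpha = \sigma^2 / c$. For $t \ge 0$ and the mixture distribution $P_t = \mathcal N(\mu_t, T_t)$ with $\mu_t = 0$ and $T_t = c\,\Phi_t \Phi_t^\top$, put $$R_{\mathrm{MM},t}^2 = (\mu_t - \mathbf r_t)^\top \Big(1 + \tfrac{T_t}{\sigma^2}\Big)^{-1} (\mu_t - \mathbf r_t) + \sigma^2 \ln\det\Big(1 + \tfrac{T_t}{\sigma^2}\Big) + 2 \sigma^2 \ln\tfrac1\delta ,$$ $$\Theta_t = \{\theta \in \mathbb{R}^d : \|\Phi_t \theta - \mathbf r_t\|_2 \le R_{\mathrm{MM},t},\ \|\theta\|_2 \le B\}, \qquad \mathrm{UCB}_t(a) = \max_{\theta \in \Theta_t} \phi(a)^\top \theta ,$$ $$R_{\mathrm{AMM},t}^2 = R_{\mathrm{MM},t}^2 + \alpha B^2 - \mathbf r_t^\top \mathbf r_t + \mathbf r_t^\top \Phi_t (\Phi_t^\top \Phi_t + \alpha 1)^{-1} \Phi_t^\top \mathbf r_t ,$$ $$\mathrm{AUCB}_t(a) = \phi(a)^\top (\Phi_t^\top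 \Phi_t + \alpha 1)^{-1} \Phi_t^\top \mathbf r_t + R_{\mathrm{AMM},t} \sqrt{\phi(a)^\top (\Phi_t^\top \Phi_t + \alpha 1)^{-1} \phi(a)} .$$ (Where $\Theta_t = \emptyset$, $\mathrm{UCB}_t$ is taken to be constant.) CMM-UCB plays $a_{t+1} \in \operatorname{argmax}_{a \in \mathcal A_{t+1}} \mathrm{UCB}_t(a)$ for all $t \ge 0$, and AMM-UCB plays $a_{t+1} \in \operatorname{argmax}_{a \in \mathcal A_{t+1}} \mathrm{AUCB}_t(a)$ for all $t \ge 0$. The cumulative regret after $T$ rounds is $\Delta_{1:T} = \sum_{t=1}^T \big(\sup_{a \in \mathcal A_t} \phi(a)^\top \theta^* - \phi(a_t)^\top \theta^*\big)$. If the actions are played by CMM-UCB or by AMM-UCB, then for all $T \ge 1$, with probability at least $1 - \delta$, $$\Delta_{1:T} \le \frac{2}{\sqrt{\ln 2}} \max\left\{C,\ \sigma \sqrt{d \ln\Big(1 + \frac{c L^2 T}{\sigma^2 d}\Big) + \frac{B^2}{c} + 2 \ln\frac1\delta}\right\} \sqrt{d T \ln\Big(1 + \frac{c L^2 T}{\sigma^2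 d}\Big)} .$$ Moreover, this bound is $\mathcal O(d \sqrt T \ln T)$: there is a constant $K$ that depends only on $\sigma, c, L, B, C, \delta$ such that the right-hand side is at most $K d \sqrt T \ln T$ for all $d \ge 1$ and $T \ge 2$. -/

import Mathlib

open MeasureTheory Matrix

noncomputable section

namespace LinBandit

/-! Rounds are indexed from `0`: index `t` stands for round `t + 1`, so that `t` observations
(those with indices `k < t`) are available when the action with index `t` is chosen. -/

section Interaction

variable {Ω Act : Type*} {d : ℕ}

/-- The reward `φ(a)ᵀ θ* + ε` received in each round. -/
def reward (φ : Act → EuclideanSpace ℝ (Fin d)) (θs : EuclideanSpace ℝ (Fin d))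
    (a : ℕ → Ω → Act) (ε : ℕ → Ω → ℝ) (t : ℕ) (ω : Ω) : ℝ :=
  inner ℝ (φ (a t ω)) θs + ε t ω

/-- The σ-algebra generated by the first `t` actions and rewards and by the next action. -/
@[reducible] def history [MeasurableSpace Act] (a : ℕ → Ω → Act) (r : ℕ → Ω → ℝ) (t : ℕ) :
    MeasurableSpace Ω :=
  (⨆ k : Fin t, (MeasurableSpace.comap (a k) inferInstance ⊔
    MeasurableSpace.comap (r k) inferInstance)) ⊔ MeasurableSpace.comap (a t) inferInstance

/-- Each noise variable is conditionally zero-mean and `σ`-sub-Gaussian, given the past actions and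
rewards and the current action.  (Integrability is required since `μ[f | m]` is `0` by convention
when `f` is not integrable.) -/
def SubGaussianNoise [MeasurableSpace Act] [MeasurableSpace Ω] (μ : Measure Ω)
    (a : ℕ → Ω → Act) (r ε : ℕ → Ω → ℝ) (σ : ℝ) : Prop :=
  ∀ t : ℕ,
    (Integrable (ε t) μ ∧ μ[ε t | history a r t] =ᵐ[μ] fun _ => (0 : ℝ)) ∧
    ∀ l : ℝ, Integrable (fun ω => Real.exp (l * ε t ω)) μ ∧
      μ[fun ω => Real.exp (l * ε t ω) | history a r t] ≤ᵐ[μ]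
        fun _ => Real.exp (l ^ 2 * σ ^ 2 / 2)

/-- The regret of the round with index `t`: the best expected reward over the action set `A t ω`
minus the expected reward of the action played. -/
def regret (φ : Act → EuclideanSpace ℝ (Fin d)) (θs : EuclideanSpace ℝ (Fin d))
    (A : ℕ → Ω → Set Act) (a : ℕ → Ω → Act) (t : ℕ) (ω : Ω) : ℝ :=
  sSup ((fun b => inner ℝ (φ b) θs) '' A t ω) - inner ℝ (φ (a t ω)) θs

/-- The cumulative regret of the first `T` rounds. -/
def cumRegret (φ : Act → EuclideanSpace ℝ (Fin d)) (θs : EuclideanSpace ℝ (Fin d))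
    (A : ℕ → Ω → Set Act) (a : ℕ → Ω → Act) (T : ℕ) (ω : Ω) : ℝ :=
  ∑ t ∈ Finset.range T, regret φ θs A a t ω

/-- The matrix `Φ_t` whose rows are the feature vectors of the first `t` actions. -/
def design (φ : Act → EuclideanSpace ℝ (Fin d)) (a : ℕ → Ω → Act) (t : ℕ) (ω : Ω) :
    Matrix (Fin t) (Fin d) ℝ :=
  Matrix.of fun k i => φ (a k ω) i

/-- The vector of the first `t` rewards. -/
def rewardVec (r : ℕ → Ω → ℝ) (t : ℕ) (ω : Ω) : Fin t → ℝ :=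
  fun k => r k ω

end Interaction

section ConfidenceBounds

variable {t d : ℕ}

/-- The squared radius `R_MM²` for the mixture distribution `𝒩(m, S)`:
`(m - r)ᵀ (1 + S/σ²)⁻¹ (m - r) + σ² ln det (1 + S/σ²) + 2 σ² ln (1/δ)`. -/
def sqRadiusMM (σ δ : ℝ) (r m : Fin t → ℝ) (S : Matrix (Fin t) (Fin t) ℝ) : ℝ :=
  (m - r) ⬝ᵥ ((1 + (σ ^ 2)⁻¹ • S)⁻¹ *ᵥ (m - r)) +
    σ ^ 2 * Real.log (1 + (σ ^ 2)⁻¹ • S).det + 2 * σ ^ 2 * Real.log (1 / δ)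

/-- The confidence set `Θ = {θ : ‖Φ θ - r‖₂ ≤ R_MM and ‖θ‖₂ ≤ B}`. -/
def confSet (σ δ B : ℝ) (Φ : Matrix (Fin t) (Fin d) ℝ) (r m : Fin t → ℝ)
    (S : Matrix (Fin t) (Fin t) ℝ) : Set (EuclideanSpace ℝ (Fin d)) :=
  {θ | ‖WithLp.toLp 2 (Φ *ᵥ θ.ofLp - r)‖ ≤ √(sqRadiusMM σ δ r m S) ∧ ‖θ‖ ≤ B}

/-- The upper confidence bound `max_{θ ∈ Θ} xᵀ θ` at the feature vector `x`.
(`Θ` is compact; if it is empty, all actions have the same value.) -/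
def ucb (σ δ B : ℝ) (Φ : Matrix (Fin t) (Fin d) ℝ) (r m : Fin t → ℝ)
    (S : Matrix (Fin t) (Fin t) ℝ) (x : EuclideanSpace ℝ (Fin d)) : ℝ :=
  sSup ((fun θ => inner ℝ x θ) '' confSet σ δ B Φ r m S)

/-- The regularised Gram matrix `Φᵀ Φ + α 1`. -/
def gram (α : ℝ) (Φ : Matrix (Fin t) (Fin d) ℝ) : Matrix (Fin d) (Fin d) ℝ :=
  Φᵀ * Φ + α • (1 : Matrix (Fin d) (Fin d) ℝ)

/-- The regularised least squares estimate `(Φᵀ Φ + α 1)⁻¹ Φᵀ r`. -/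
def ridge (α : ℝ) (Φ : Matrix (Fin t) (Fin d) ℝ) (r : Fin t → ℝ) : Fin d → ℝ :=
  (gram α Φ)⁻¹ *ᵥ (Φᵀ *ᵥ r)

/-- The squared radius `R_AMM² = R_MM² + α B² - rᵀ r + rᵀ Φ (Φᵀ Φ + α 1)⁻¹ Φᵀ r`. -/
def sqRadiusAMM (σ δ B α : ℝ) (Φ : Matrix (Fin t) (Fin d) ℝ) (r m : Fin t → ℝ)
    (S : Matrix (Fin t) (Fin t) ℝ) : ℝ :=
  sqRadiusMM σ δ r m S + α * B ^ 2 - r ⬝ᵥ r + r ⬝ᵥ (Φ *ᵥ ((gram α Φ)⁻¹ *ᵥ (Φᵀ *ᵥ r)))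

/-- The analytic upper confidence bound at the feature vector `x`. -/
def aucb (σ δ B α : ℝ) (Φ : Matrix (Fin t) (Fin d) ℝ) (r m : Fin t → ℝ)
    (S : Matrix (Fin t) (Fin t) ℝ) (x : EuclideanSpace ℝ (Fin d)) : ℝ :=
  x.ofLp ⬝ᵥ ridge α Φ r +
    √(sqRadiusAMM σ δ B α Φ r m S) * √(x.ofLp ⬝ᵥ ((gram α Φ)⁻¹ *ᵥ x.ofLp))

end ConfidenceBounds

section Algorithms

variable {Ω Act : Type*} {d : ℕ}

/-- The actions are those of CMM-UCB run with the mixture distributions `𝒩(m t, S t)`: each action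
maximises the upper confidence bound over the current action set. -/
def IsCMMUCB (σ δ B : ℝ) (m : (t : ℕ) → Ω → Fin t → ℝ)
    (S : (t : ℕ) → Ω → Matrix (Fin t) (Fin t) ℝ) (φ : Act → EuclideanSpace ℝ (Fin d))
    (A : ℕ → Ω → Set Act) (a : ℕ → Ω → Act) (r : ℕ → Ω → ℝ) : Prop :=
  ∀ t ω, a t ω ∈ A t ω ∧
    IsMaxOn (fun b => ucb σ δ B (design φ a t ω) (rewardVec r t ω) (m t ω) (S t ω) (φ b))
      (A t ω) (a t ω)

/-- The actions are those of AMM-UCB run with the mixture distributions `𝒩(m t, S t)` and the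
parameter `α`: each action maximises the analytic upper confidence bound over the current action
set. -/
def IsAMMUCB (σ δ B α : ℝ) (m : (t : ℕ) → Ω → Fin t → ℝ)
    (S : (t : ℕ) → Ω → Matrix (Fin t) (Fin t) ℝ) (φ : Act → EuclideanSpace ℝ (Fin d))
    (A : ℕ → Ω → Set Act) (a : ℕ → Ω → Act) (r : ℕ → Ω → ℝ) : Prop :=
  ∀ t ω, a t ω ∈ A t ω ∧
    IsMaxOn (fun b => aucb σ δ B α (design φ a t ω) (rewardVec r t ω) (m t ω) (S t ω) (φ b))
      (A t ω) (a t ω)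

/-- The covariance matrices `c Φ_t Φ_tᵀ`. -/
def scaledCov (c : ℝ) (φ : Act → EuclideanSpace ℝ (Fin d)) (a : ℕ → Ω → Act) (t : ℕ) (ω : Ω) :
    Matrix (Fin t) (Fin t) ℝ :=
  c • (design φ a t ω * (design φ a t ω)ᵀ)

end Algorithms

/-- The data-independent regret bound. -/
def regretBound (σ c L B C δ : ℝ) (d T : ℕ) : ℝ :=
  2 / √(Real.log 2) *
    max C (σ * √(d * Real.log (1 + c * L ^ 2 * T / (σ ^ 2 * d)) + B ^ 2 / c +
      2 * Real.log (1 / δ))) *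
    √(d * T * Real.log (1 + c * L ^ 2 * T / (σ ^ 2 * d)))

end LinBandit

end

noncomputable section

namespace LinBandit

/-! ### Linear algebra of the regularised Gram matrix -/

section LinearAlgebra

variable {t d : ℕ}

/-! Write `V = Φᵀ Φ + α 1` with `α = σ² / c`. Confidence: for fixed `v`, the Gaussian likelihood
ratio of `v` against `θ*` is a nonnegative supermartingale, since its log-increment is `l ε - l² σ²
/ 2` with `l` determined by the history. Averaging over a centred Gaussian prior with covariance `c
1` on `v` preserves this. Completing the square evaluates the mixture in closed form, and Ville's
inequality at level `1 / δ` times the initial mass says exactly that `θ*` obeys the residual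
constraint of every `Θ_t` up to the horizon, with probability at least `1 - δ`
(`exists_confidence_event`).

Regret: on that event everything is deterministic. Adding `α` times the norm constraint to the
residual constraint encloses `Θ_t` in an ellipsoid around the ridge estimate, so `φᵀ θ* ≤ UCB ≤
AUCB`. Optimism then bounds the regret of either algorithm by twice `R_AMM` times the `V⁻¹`-norm of
the played feature (`regret_le_of_optimism`).

For this `α` the Woodbury identity cancels all reward terms in `R_AMM²`, leaving a log-determinant
that the trace bound controls (`sqRadiusAMM_scaledCov_le`). The squared widths, truncated at 1, sum
to at most the same log-determinant over `ln 2`; Cauchy-Schwarz over the rounds finishes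
(`cumRegret_le_regretBound`). -/

theorem posDef_gram {α : ℝ} (hα : 0 < α) (Φ : Matrix (Fin t) (Fin d) ℝ) : (gram α Φ).PosDef := by
  have h := Matrix.posSemidef_conjTranspose_mul_self Φ
  rw [conjTranspose_eq_transpose_of_trivial] at h
  exact Matrix.PosDef.posSemidef_add h (Matrix.PosDef.one.smul hα)

theorem isUnit_det_gram {α : ℝ} (hα : 0 < α) (Φ : Matrix (Fin t) (Fin d) ℝ) :
    IsUnit (gram α Φ).det :=
  (posDef_gram hα Φ).det_pos.ne'.isUnit

theorem transpose_gram (α : ℝ) (Φ : Matrix (Fin t) (Fin d) ℝ) : (gram α Φ)ᵀ = gram α Φ := by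
  simp [gram]

/-- Push-through form of the Woodbury identity. -/
theorem inv_one_add_smul_mul_transpose {α : ℝ} (hα : 0 < α) (Φ : Matrix (Fin t) (Fin d) ℝ) :
    (1 + α⁻¹ • (Φ * Φᵀ))⁻¹ = 1 - Φ * (gram α Φ)⁻¹ * Φᵀ := by
  apply Matrix.inv_eq_right_inv
  have h : Φᵀ * Φ = gram α Φ - α • 1 := by simp [gram]
  have h1 : Φ * Φᵀ * (Φ * (gram α Φ)⁻¹ * Φᵀ) = Φ * Φᵀ - α • (Φ * (gram α Φ)⁻¹ * Φᵀ) := by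
    calc Φ * Φᵀ * (Φ * (gram α Φ)⁻¹ * Φᵀ) = Φ * ((Φᵀ * Φ) * (gram α Φ)⁻¹) * Φᵀ := by
          simp only [Matrix.mul_assoc]
      _ = _ := by
          rw [h, Matrix.sub_mul, Matrix.mul_nonsing_inv _ (isUnit_det_gram hα Φ)]
          simp [Matrix.mul_sub, Matrix.sub_mul]
  rw [Matrix.mul_sub, Matrix.add_mul 1 _ (Φ * (gram α Φ)⁻¹ * Φᵀ), Matrix.smul_mul, h1, smul_sub,
    smul_smul, inv_mul_cancel₀ hα.ne']
  simp

/-- Sylvester's identity `det (1 + X Y) = det (1 + Y X)` trades the `t × t` determinant of the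
radius for the `d × d` one of the elliptical potential. -/
theorem det_one_add_smul_mul_transpose {α : ℝ} (hα : 0 < α) (Φ : Matrix (Fin t) (Fin d) ℝ) :
    (1 + α⁻¹ • (Φ * Φᵀ)).det = (α ^ d)⁻¹ * (gram α Φ).det := by
  rw [← Matrix.smul_mul, Matrix.det_one_add_mul_comm, gram]
  have h : 1 + Φᵀ * α⁻¹ • Φ = α⁻¹ • (Φᵀ * Φ + α • (1 : Matrix (Fin d) (Fin d) ℝ)) := by
    rw [smul_add, smul_smul, inv_mul_cancel₀ hα.ne', one_smul, Matrix.mul_smul, add_comm]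
  rw [h, Matrix.det_smul]
  simp

theorem dotProduct_mulVec_comm_of_transpose_eq {V : Matrix (Fin d) (Fin d) ℝ} (hV : Vᵀ = V)
    (x y : Fin d → ℝ) : x ⬝ᵥ (V *ᵥ y) = y ⬝ᵥ (V *ᵥ x) := by
  rw [Matrix.dotProduct_mulVec, ← Matrix.mulVec_transpose, hV, dotProduct_comm]

theorem gram_mulVec_ridge {α : ℝ} (hα : 0 < α) (Φ : Matrix (Fin t) (Fin d) ℝ) (r : Fin t → ℝ) :
    gram α Φ *ᵥ ridge α Φ r = Φᵀ *ᵥ r := by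
  rw [ridge, Matrix.mulVec_mulVec, Matrix.mul_nonsing_inv _ (isUnit_det_gram hα Φ),
    Matrix.one_mulVec]

theorem dotProduct_gram_mulVec (α : ℝ) (Φ : Matrix (Fin t) (Fin d) ℝ) (v w : Fin d → ℝ) :
    v ⬝ᵥ (gram α Φ *ᵥ w) = (Φ *ᵥ v) ⬝ᵥ (Φ *ᵥ w) + α * (v ⬝ᵥ w) := by
  rw [gram, Matrix.add_mulVec, dotProduct_add, ← Matrix.mulVec_mulVec, Matrix.smul_mulVec,
    Matrix.one_mulVec, dotProduct_smul, smul_eq_mul, Matrix.dotProduct_mulVec v Φᵀ,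
    Matrix.vecMul_transpose]

/-- Completing the square in the regularised least squares objective. -/
theorem regularized_sq_loss_eq {α : ℝ} (hα : 0 < α) (Φ : Matrix (Fin t) (Fin d) ℝ)
    (r : Fin t → ℝ) (v : Fin d → ℝ) :
    (Φ *ᵥ v - r) ⬝ᵥ (Φ *ᵥ v - r) + α * (v ⬝ᵥ v) =
      (v - ridge α Φ r) ⬝ᵥ (gram α Φ *ᵥ (v - ridge α Φ r)) + r ⬝ᵥ r -
        r ⬝ᵥ (Φ *ᵥ ((gram α Φ)⁻¹ *ᵥ (Φᵀ *ᵥ r))) := by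
  have h1 : v ⬝ᵥ (gram α Φ *ᵥ ridge α Φ r) = (Φ *ᵥ v) ⬝ᵥ r := by
    rw [gram_mulVec_ridge hα, Matrix.dotProduct_mulVec, Matrix.vecMul_transpose]
  have h2 : ridge α Φ r ⬝ᵥ (gram α Φ *ᵥ ridge α Φ r) =
      r ⬝ᵥ (Φ *ᵥ ((gram α Φ)⁻¹ *ᵥ (Φᵀ *ᵥ r))) := by
    rw [gram_mulVec_ridge hα, Matrix.dotProduct_mulVec, Matrix.vecMul_transpose, dotProduct_comm]
    rfl
  simp only [Matrix.mulVec_sub, sub_dotProduct, dotProduct_sub]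
  rw [dotProduct_mulVec_comm_of_transpose_eq (transpose_gram α Φ) (ridge α Φ r) v, h1, h2,
    dotProduct_gram_mulVec, dotProduct_comm r (Φ *ᵥ v)]
  ring

/-- Cauchy-Schwarz for the inner product given by a positive definite matrix. -/
theorem sq_dotProduct_le_of_posDef {V : Matrix (Fin d) (Fin d) ℝ} (hV : V.PosDef)
    (x u : Fin d → ℝ) : (x ⬝ᵥ u) ^ 2 ≤ (x ⬝ᵥ (V⁻¹ *ᵥ x)) * (u ⬝ᵥ (V *ᵥ u)) := by
  have hVt : Vᵀ = V := by
    simpa [conjTranspose_eq_transpose_of_trivial] using hV.isHermitian.eq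
  have hu : IsUnit V.det := hV.det_pos.ne'.isUnit
  set y := V⁻¹ *ᵥ x with hy
  have hx : V *ᵥ y = x := by
    rw [hy, Matrix.mulVec_mulVec, Matrix.mul_nonsing_inv _ hu, Matrix.one_mulVec]
  -- The quadratic form of `V` at `s u + V⁻¹ x` is a nonnegative quadratic in `s`, so its
  -- discriminant is nonpositive.
  have key : ∀ s : ℝ, 0 ≤ (u ⬝ᵥ (V *ᵥ u)) * (s * s) + (2 * (x ⬝ᵥ u)) * s + x ⬝ᵥ y := by
    intro s
    have h := hV.posSemidef.dotProduct_mulVec_nonneg (s • u + y)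
    have h1 : y ⬝ᵥ (V *ᵥ u) = x ⬝ᵥ u := by
      rw [dotProduct_mulVec_comm_of_transpose_eq hVt, hx, dotProduct_comm]
    simp only [star_trivial, Matrix.mulVec_add, Matrix.mulVec_smul, hx, add_dotProduct,
      dotProduct_add, smul_dotProduct, dotProduct_smul, smul_eq_mul, h1] at h
    rw [dotProduct_comm u x, dotProduct_comm y x] at h
    linarith
  have h := discrim_le_zero key
  rw [discrim] at h
  nlinarith

theorem abs_dotProduct_le_of_posDef {V : Matrix (Fin d) (Fin d) ℝ} (hV : V.PosDef) {R : ℝ}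
    (x u : Fin d → ℝ) (hu : u ⬝ᵥ (V *ᵥ u) ≤ R) :
    |x ⬝ᵥ u| ≤ √R * √(x ⬝ᵥ (V⁻¹ *ᵥ x)) := by
  have hx : 0 ≤ x ⬝ᵥ (V⁻¹ *ᵥ x) := by
    simpa using hV.inv.posSemidef.dotProduct_mulVec_nonneg x
  have hu0 : 0 ≤ u ⬝ᵥ (V *ᵥ u) := by
    simpa using hV.posSemidef.dotProduct_mulVec_nonneg u
  rw [← Real.sqrt_mul (hu0.trans hu), mul_comm]
  apply Real.abs_le_sqrt
  exact (sq_dotProduct_le_of_posDef hV x u).trans (mul_le_mul_of_nonneg_left hu hx)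

/-- The arithmetic-geometric mean inequality for the eigenvalues of a positive definite matrix. -/
theorem log_det_le_of_trace_le {V : Matrix (Fin d) (Fin d) ℝ} (hV : V.PosDef) {m : ℝ}
    (hm : 0 < m) (htr : V.trace ≤ d * m) : Real.log V.det ≤ d * Real.log m := by
  have hpos := hV.eigenvalues_pos
  rw [hV.isHermitian.det_eq_prod_eigenvalues, ← RCLike.ofReal_prod]
  rw [hV.isHermitian.trace_eq_sum_eigenvalues] at htr
  simp only [RCLike.ofReal_real_eq_id, id_eq] at htr ⊢
  rw [Real.log_prod fun i _ => (hpos i).ne']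
  -- Each logarithm lies below its tangent line at `m`; after summation the trace bound removes the
  -- linear terms.
  calc ∑ i, Real.log (hV.isHermitian.eigenvalues i)
      ≤ ∑ i, (hV.isHermitian.eigenvalues i / m - 1 + Real.log m) := by
        refine Finset.sum_le_sum fun i _ => ?_
        have h := Real.log_le_sub_one_of_pos (div_pos (hpos i) hm)
        rw [Real.log_div (hpos i).ne' hm.ne'] at h
        linarith
    _ = (∑ i, hV.isHermitian.eigenvalues i) / m - d + d * Real.log m := by
        simp [Finset.sum_add_distrib, Finset.sum_div]
    _ ≤ d * Real.log m := by
        have : (∑ i, hV.isHermitian.eigenvalues i) / m ≤ d := by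
          rwa [div_le_iff₀ hm]
        linarith

theorem trace_gram (α : ℝ) (Φ : Matrix (Fin t) (Fin d) ℝ) :
    (gram α Φ).trace = ∑ k, Φ k ⬝ᵥ Φ k + d * α := by
  rw [gram, Matrix.trace_add, Matrix.trace_mul_comm, Matrix.trace_smul, Matrix.trace_one]
  simp [Matrix.trace, Matrix.mul_apply, dotProduct, mul_comm]

theorem log_det_gram_le {α L : ℝ} (hα : 0 < α) (hd : 1 ≤ d) (Φ : Matrix (Fin t) (Fin d) ℝ)
    (hΦ : ∀ k, Φ k ⬝ᵥ Φ k ≤ L ^ 2) :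
    Real.log ((α ^ d)⁻¹ * (gram α Φ).det) ≤ d * Real.log (1 + L ^ 2 * t / (α * d)) := by
  have hd' : (0 : ℝ) < d := by exact_mod_cast hd
  have hm : 0 < 1 + L ^ 2 * t / (α * d) := by positivity
  -- The trace is at most `t L² + d α`, so this `m` bounds the mean eigenvalue.
  have h := log_det_le_of_trace_le (posDef_gram hα Φ) (m := α * (1 + L ^ 2 * t / (α * d)))
    (by positivity) (by
      rw [trace_gram]
      have h1 : ∑ k, Φ k ⬝ᵥ Φ k ≤ t * L ^ 2 := by
        simpa using Finset.sum_le_sum fun k (_ : k ∈ Finset.univ) => hΦ k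
      have h2 : (d : ℝ) * (α * (1 + L ^ 2 * t / (α * d))) = d * α + t * L ^ 2 := by
        field_simp
      linarith)
  rw [Real.log_mul hα.ne' hm.ne'] at h
  rw [Real.log_mul (by positivity) (posDef_gram hα Φ).det_pos.ne', Real.log_inv, Real.log_pow]
  linarith

theorem gram_succ (α : ℝ) (Φ : Matrix (Fin (t + 1)) (Fin d) ℝ) :
    gram α Φ = gram α (Φ.submatrix Fin.castSucc id) +
      replicateCol Unit (Φ (Fin.last t)) * replicateRow Unit (Φ (Fin.last t)) := by
  ext i j
  simp [gram, Matrix.mul_apply, Fin.sum_univ_castSucc]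
  ring

/-- The determinant of the Gram matrix after a rank-one update. -/
theorem det_gram_succ {α : ℝ} (hα : 0 < α) (Φ : Matrix (Fin (t + 1)) (Fin d) ℝ) :
    (gram α Φ).det = (gram α (Φ.submatrix Fin.castSucc id)).det *
      (1 + Φ (Fin.last t) ⬝ᵥ ((gram α (Φ.submatrix Fin.castSucc id))⁻¹ *ᵥ Φ (Fin.last t))) := by
  rw [gram_succ, Matrix.det_add_replicateCol_mul_replicateRow (isUnit_det_gram hα _)]
  congr 1
  rw [det_unique, Matrix.add_apply, Matrix.one_apply_eq, Matrix.mul_assoc]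
  congr 1

theorem norm_toLp_sq (v : Fin t → ℝ) : ‖WithLp.toLp 2 v‖ ^ 2 = v ⬝ᵥ v := by
  rw [EuclideanSpace.norm_sq_eq]
  simp [dotProduct, sq]

theorem norm_sq_eq_dotProduct (v : EuclideanSpace ℝ (Fin d)) : ‖v‖ ^ 2 = v.ofLp ⬝ᵥ v.ofLp :=
  norm_toLp_sq v.ofLp

theorem inner_eq_dotProduct (x y : EuclideanSpace ℝ (Fin d)) :
    inner ℝ x y = x.ofLp ⬝ᵥ y.ofLp := by
  rw [EuclideanSpace.inner_eq_star_dotProduct, dotProduct_comm]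
  simp

end LinearAlgebra

open scoped ENNReal

/-! ### Ville's inequality and sub-Gaussian increments -/

section Supermartingale

variable {Ω : Type*} {m mΩ : MeasurableSpace Ω}

/-- Ville's maximal inequality for a nonnegative supermartingale, the supermartingale property
being expressed by integrals over past events. -/
theorem meas_exists_le_mul_le_lintegral (μ : Measure Ω) (ℱ : ℕ → MeasurableSpace Ω)
    (hℱ : Monotone ℱ) (hle : ∀ t, ℱ t ≤ mΩ) (M : ℕ → Ω → ℝ≥0∞) (hM : ∀ t, Measurable[ℱ t] (M t))
    (hsup : ∀ t (s : Set Ω), MeasurableSet[ℱ t] s →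
      ∫⁻ ω in s, M (t + 1) ω ∂μ ≤ ∫⁻ ω in s, M t ω ∂μ) (c : ℝ≥0∞) (n : ℕ) :
    c * μ {ω | ∃ t ≤ n, c ≤ M t ω} ≤ ∫⁻ ω, M 0 ω ∂μ := by
  have hlev : ∀ t, MeasurableSet[ℱ t] {ω | c ≤ M t ω} := fun t =>
    hM t measurableSet_Ici
  have hcross : ∀ n, MeasurableSet[ℱ n] {ω | ∃ t ≤ n, c ≤ M t ω} := fun n => by
    have : {ω | ∃ t ≤ n, c ≤ M t ω} = ⋃ t ∈ Set.Iic n, {ω | c ≤ M t ω} := by ext; simp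
    rw [this]
    exact MeasurableSet.biUnion (Set.to_countable _) fun t ht => hℱ ht _ (hlev t)
  -- The induction needs a stronger claim that retains the mass of `M n` on the paths that have not
  -- yet crossed.
  have key : ∀ n, c * μ {ω | ∃ t ≤ n, c ≤ M t ω} +
      ∫⁻ ω in {ω | ∃ t ≤ n, c ≤ M t ω}ᶜ, M n ω ∂μ ≤ ∫⁻ ω, M 0 ω ∂μ := by
    intro n
    induction n with
    | zero =>
      have h0 : {ω | ∃ t ≤ 0, c ≤ M t ω} = {ω | c ≤ M 0 ω} := by ext; simp
      rw [h0, ← lintegral_add_compl (μ := μ) (M 0) (hle 0 _ (hlev 0))]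
      gcongr
      rw [← setLIntegral_const]
      exact setLIntegral_mono ((hM 0).mono (hle 0) le_rfl) fun ω hω => hω
    | succ n ih =>
      set S := {ω | ∃ t ≤ n, c ≤ M t ω} with hS
      set U := {ω | c ≤ M (n + 1) ω} with hU
      have hSm : MeasurableSet S := hle n _ (hcross n)
      have hUm : MeasurableSet U := hle (n + 1) _ (hlev (n + 1))
      have hsucc : {ω | ∃ t ≤ n + 1, c ≤ M t ω} = S ∪ (Sᶜ ∩ U) := by
        rw [Set.union_inter_distrib_left, Set.union_compl_self, Set.univ_inter]
        ext ω
        simp only [hS, hU, Set.mem_ofPred_eq, Set.mem_union]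
        constructor
        · rintro ⟨t, ht, h⟩
          rcases Nat.le_succ_iff.1 ht with h' | rfl
          · exact Or.inl ⟨t, h', h⟩
          · exact Or.inr h
        · rintro (⟨t, ht, h⟩ | h)
          · exact ⟨t, ht.trans n.le_succ, h⟩
          · exact ⟨n + 1, le_rfl, h⟩
      have hcompl : (S ∪ (Sᶜ ∩ U))ᶜ = Sᶜ \ U := by
        ext ω
        simp only [Set.mem_compl_iff, Set.mem_union, Set.mem_inter_iff, Set.mem_sdiff]
        tauto
      rw [hsucc, hcompl, measure_union (Set.disjoint_left.2 fun ω h h' => h'.1 h)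
        (hSm.compl.inter hUm), mul_add, add_assoc]
      refine le_trans ?_ ih
      gcongr
      -- Not having crossed by time `n` is a past event, so the supermartingale inequality applies
      -- on it; the step then splits according to a crossing at `n + 1`.
      refine le_trans ?_ (hsup n _ (hcross n).compl)
      rw [← lintegral_inter_add_sdiff (M (n + 1)) Sᶜ hUm]
      gcongr
      rw [← setLIntegral_const]
      exact setLIntegral_mono ((hM _).mono (hle _) le_rfl) fun ω hω => hω.2
  exact le_self_add.trans (key n)

/-- A conditionally sub-Gaussian variable satisfies the exponential moment bound with a random
multiplier that is measurable with respect to the conditioning σ-algebra. -/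
theorem lintegral_mul_exp_le_of_condExp_le {μ : Measure Ω} [IsFiniteMeasure μ]
    (hm : m ≤ mΩ) {e : Ω → ℝ} (he : Measurable e) {σ : ℝ}
    (hint : ∀ l : ℝ, Integrable (fun ω => Real.exp (l * e ω)) μ)
    (hsub : ∀ l : ℝ, μ[fun ω => Real.exp (l * e ω) | m] ≤ᵐ[μ]
      fun _ => Real.exp (l ^ 2 * σ ^ 2 / 2))
    {l : Ω → ℝ} (hl : Measurable[m] l) {W : Ω → ℝ≥0∞} (hW : Measurable[m] W) :
    ∫⁻ ω, W ω * ENNReal.ofReal (Real.exp (l ω * e ω - l ω ^ 2 * σ ^ 2 / 2)) ∂μ ≤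
      ∫⁻ ω, W ω ∂μ := by
  -- The multiplier is treated in stages: constant, then simple by splitting along its fibres, then
  -- general by Fatou's lemma.
  have hconst : ∀ (x : ℝ) (s : Set Ω), MeasurableSet[m] s →
      ∫⁻ ω in s, ENNReal.ofReal (Real.exp (x * e ω - x ^ 2 * σ ^ 2 / 2)) ∂μ ≤ μ s := by
    intro x s hs
    have hI : Integrable (fun ω => Real.exp (x * e ω - x ^ 2 * σ ^ 2 / 2)) μ := by
      simp_rw [sub_eq_add_neg, Real.exp_add]
      exact (hint x).mul_const _
    rw [← ofReal_integral_eq_lintegral_ofReal hI.integrableOn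
      (ae_of_all _ fun _ => (Real.exp_pos _).le)]
    have h1 : ∫ ω in s, Real.exp (x * e ω) ∂μ ≤ Real.exp (x ^ 2 * σ ^ 2 / 2) * μ.real s := by
      rw [← setIntegral_condExp hm (hint x) hs]
      calc ∫ ω in s, (μ[fun ω => Real.exp (x * e ω) | m]) ω ∂μ
          ≤ ∫ _ in s, Real.exp (x ^ 2 * σ ^ 2 / 2) ∂μ :=
            setIntegral_mono_ae integrable_condExp.integrableOn
              (integrable_const _).integrableOn (hsub x)
        _ = _ := by simp [mul_comm]
    refine ENNReal.ofReal_le_of_le_toReal ?_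
    simp_rw [Real.exp_sub, integral_div]
    rw [div_le_iff₀ (Real.exp_pos _), mul_comm]
    exact h1
  have hsimple : ∀ (f : @SimpleFunc Ω m ℝ) (s : Set Ω), MeasurableSet[m] s →
      ∫⁻ ω in s, ENNReal.ofReal (Real.exp (f ω * e ω - f ω ^ 2 * σ ^ 2 / 2)) ∂μ ≤ μ s := by
    intro f s hs
    have hfib : ∀ x, MeasurableSet[m] (f ⁻¹' {x}) := fun x => @SimpleFunc.measurableSet_fiber _ _ m f x
    obtain ⟨R, hR⟩ : ∃ R : Finset ℝ, ∀ ω, f ω ∈ R :=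
      ⟨@SimpleFunc.range _ _ m f, fun ω => @SimpleFunc.mem_range_self _ _ m f ω⟩
    have hdec : s = ⋃ x ∈ R, (s ∩ f ⁻¹' {x}) := by
      ext ω; simp [hR]
    have hdisj : Set.PairwiseDisjoint (R : Set ℝ) fun x => s ∩ f ⁻¹' {x} := by
      intro x _ y _ hxy
      refine Set.disjoint_left.2 fun ω h h' => hxy ?_
      rw [← h.2, ← h'.2]
    have hmeas : ∀ x ∈ R, MeasurableSet (s ∩ f ⁻¹' {x}) := fun x _ =>
      hm _ (hs.inter (hfib x))
    conv_lhs => rw [hdec]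
    conv_rhs => rw [hdec]
    rw [lintegral_biUnion_finset hdisj hmeas, measure_biUnion_finset hdisj hmeas]
    refine Finset.sum_le_sum fun x hx => ?_
    refine le_trans (le_of_eq ?_) (hconst x _ (hs.inter (hfib x)))
    refine setLIntegral_congr_fun (hmeas x hx) fun ω hω => ?_
    have : f ω = x := hω.2
    simp only [this]
  have hgen : ∀ s : Set Ω, MeasurableSet[m] s →
      ∫⁻ ω in s, ENNReal.ofReal (Real.exp (l ω * e ω - l ω ^ 2 * σ ^ 2 / 2)) ∂μ ≤ μ s := by
    intro s hs
    have hls : StronglyMeasurable[m] l := hl.stronglyMeasurable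
    have hmeas : ∀ n, Measurable fun ω => ENNReal.ofReal
        (Real.exp (hls.approx n ω * e ω - hls.approx n ω ^ 2 * σ ^ 2 / 2)) := fun n => by
      have := (@SimpleFunc.measurable _ _ m _ (hls.approx n)).mono hm le_rfl
      fun_prop
    have hlim : ∀ ω, Filter.Tendsto (fun n => ENNReal.ofReal
        (Real.exp (hls.approx n ω * e ω - hls.approx n ω ^ 2 * σ ^ 2 / 2))) Filter.atTop
        (nhds (ENNReal.ofReal (Real.exp (l ω * e ω - l ω ^ 2 * σ ^ 2 / 2)))) := fun ω => by
      have hc : Continuous fun x : ℝ =>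
          ENNReal.ofReal (Real.exp (x * e ω - x ^ 2 * σ ^ 2 / 2)) :=
        ENNReal.continuous_ofReal.comp (by fun_prop)
      exact (hc.tendsto (l ω)).comp (hls.tendsto_approx ω)
    calc ∫⁻ ω in s, ENNReal.ofReal (Real.exp (l ω * e ω - l ω ^ 2 * σ ^ 2 / 2)) ∂μ
        = ∫⁻ ω in s, Filter.liminf (fun n => ENNReal.ofReal
            (Real.exp (hls.approx n ω * e ω - hls.approx n ω ^ 2 * σ ^ 2 / 2))) Filter.atTop ∂μ :=
          lintegral_congr fun ω => (hlim ω).liminf_eq.symm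
      _ ≤ Filter.liminf (fun n => ∫⁻ ω in s, ENNReal.ofReal
            (Real.exp (hls.approx n ω * e ω - hls.approx n ω ^ 2 * σ ^ 2 / 2)) ∂μ) Filter.atTop :=
          lintegral_liminf_le hmeas
      _ ≤ μ s := Filter.liminf_le_of_le (by isBoundedDefault) fun b hb => by
          obtain ⟨n, hn⟩ := hb.exists
          exact hn.trans (hsimple _ s hs)
  set g : Ω → ℝ≥0∞ := fun ω =>
    ENNReal.ofReal (Real.exp (l ω * e ω - l ω ^ 2 * σ ^ 2 / 2)) with hg
  have hgm : Measurable g := by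
    have := hl.mono hm le_rfl
    fun_prop
  -- On `m`-measurable sets the measure with density `g` is dominated by `μ`; integrating the
  -- `m`-measurable weight `W` against both requires no integrability.
  have htrim : (μ.withDensity g).trim hm ≤ μ.trim hm := by
    refine Measure.le_iff.2 fun s hs => ?_
    rw [trim_measurableSet_eq hm hs, trim_measurableSet_eq hm hs, withDensity_apply _ (hm s hs)]
    exact hgen s hs
  calc ∫⁻ ω, W ω * g ω ∂μ = ∫⁻ ω, W ω ∂(μ.withDensity g) := by
        rw [lintegral_withDensity_eq_lintegral_mul _ hgm (hW.mono hm le_rfl)]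
        simp [mul_comm]
    _ = ∫⁻ ω, W ω ∂((μ.withDensity g).trim hm) := (lintegral_trim hm hW).symm
    _ ≤ ∫⁻ ω, W ω ∂(μ.trim hm) := lintegral_mono' htrim le_rfl
    _ = ∫⁻ ω, W ω ∂μ := lintegral_trim hm hW

end Supermartingale

/-! ### Gaussian integrals of quadratic forms -/

section GaussianIntegral

variable {d : ℕ}

/-- The Gaussian integral of a quadratic form, relative to the standard one. -/
theorem ofReal_sqrt_det_mul_lintegral_exp {V : Matrix (Fin d) (Fin d) ℝ} (hV : V.PosDef) (b : ℝ) :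
    ENNReal.ofReal √V.det *
      ∫⁻ v : Fin d → ℝ, ENNReal.ofReal (Real.exp (-(v ⬝ᵥ (V *ᵥ v)) / b)) =
    ∫⁻ v : Fin d → ℝ, ENNReal.ofReal (Real.exp (-(v ⬝ᵥ v) / b)) := by
  -- The substitution `v ↦ S v` with `S` the square root of `V` has Jacobian `√V.det`.
  open scoped MatrixOrder in
  obtain ⟨S, hSV, hSdet⟩ : ∃ S : Matrix (Fin d) (Fin d) ℝ, V = Sᵀ * S ∧ S.det = √V.det := by
    refine ⟨CFC.sqrt V, ?_, ?_⟩
    · have h1 : (CFC.sqrt V)ᵀ = CFC.sqrt V := by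
        have h := (Matrix.nonneg_iff_posSemidef.1 (CFC.sqrt_nonneg V)).isHermitian.eq
        rwa [conjTranspose_eq_transpose_of_trivial] at h
      rw [h1, CFC.sqrt_mul_sqrt_self V (Matrix.nonneg_iff_posSemidef.2 hV.posSemidef)]
    · simpa using hV.posSemidef.det_sqrt
  have hpos : 0 < S.det := hSdet ▸ Real.sqrt_pos.2 hV.det_pos
  have hquad : ∀ v : Fin d → ℝ, v ⬝ᵥ (V *ᵥ v) = (S *ᵥ v) ⬝ᵥ (S *ᵥ v) := fun v => by
    rw [hSV, ← Matrix.mulVec_mulVec, Matrix.dotProduct_mulVec v, Matrix.vecMul_transpose]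
  have hf : Measurable fun v : Fin d → ℝ => ENNReal.ofReal (Real.exp (-(v ⬝ᵥ v) / b)) := by
    unfold dotProduct
    fun_prop
  have hmap := Real.map_matrix_volume_pi_eq_smul_volume_pi hpos.ne'
  have h := lintegral_map (μ := volume) hf
    (show Measurable (toLin' S) from (LinearMap.continuous_on_pi _).measurable)
  rw [hmap, lintegral_smul_measure] at h
  simp only [Matrix.toLin'_apply, ← hquad] at h
  rw [← h, smul_eq_mul, ← mul_assoc, ← hSdet, ← ENNReal.ofReal_mul hpos.le,
    abs_of_pos (inv_pos.2 hpos), mul_inv_cancel₀ hpos.ne', ENNReal.ofReal_one, one_mul]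

/-- Being nonzero and finite, the standard Gaussian integral can be cancelled; its value is never
needed. -/
theorem lintegral_exp_neg_dotProduct_ne_zero (b : ℝ) :
    ∫⁻ v : Fin d → ℝ, ENNReal.ofReal (Real.exp (-(v ⬝ᵥ v) / b)) ≠ 0 := by
  have hf : Measurable fun v : Fin d → ℝ => ENNReal.ofReal (Real.exp (-(v ⬝ᵥ v) / b)) := by
    unfold dotProduct
    fun_prop
  refine ((lintegral_pos_iff_support hf).2 ?_).ne'
  have : Function.support (fun v : Fin d → ℝ => ENNReal.ofReal (Real.exp (-(v ⬝ᵥ v) / b))) =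
      Set.univ := by
    ext v
    simp [Real.exp_pos]
  rw [this]
  exact Measure.measure_univ_pos.2 (NeZero.ne _)

theorem lintegral_exp_neg_dotProduct_ne_top {b : ℝ} (hb : 0 < b) :
    ∫⁻ v : Fin d → ℝ, ENNReal.ofReal (Real.exp (-(v ⬝ᵥ v) / b)) ≠ ∞ := by
  have h1 : Integrable fun v : Fin d → ℝ => ∏ i, Real.exp (-b⁻¹ * v i ^ 2) :=
    Integrable.fintype_prod (f := fun _ x => Real.exp (-b⁻¹ * x ^ 2)) fun _ =>
      integrable_exp_neg_mul_sq (inv_pos.2 hb)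
  have h2 : (fun v : Fin d → ℝ => ∏ i, Real.exp (-b⁻¹ * v i ^ 2)) =
      fun v => Real.exp (-(v ⬝ᵥ v) / b) := by
    ext v
    rw [← Real.exp_sum, ← Finset.mul_sum]
    congr 1
    simp only [dotProduct, ← sq]
    ring
  rw [h2] at h1
  exact h1.lintegral_lt_top.ne

end GaussianIntegral

/-! ### The mixture supermartingale and the confidence event -/

section Mixture

variable {Ω Act : Type*} {d : ℕ}

/-- The logarithm of the likelihood ratio of the parameters `v` and `θ*` after `t` rounds, with a
centred Gaussian prior on `v`, up to normalisation. -/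
def logLikelihoodRatio (σ α : ℝ) (φ : Act → EuclideanSpace ℝ (Fin d))
    (θs : EuclideanSpace ℝ (Fin d)) (a : ℕ → Ω → Act) (r : ℕ → Ω → ℝ) (t : ℕ) (v : Fin d → ℝ)
    (ω : Ω) : ℝ :=
  (∑ k ∈ Finset.range t, ((inner ℝ (φ (a k ω)) θs - r k ω) ^ 2 -
    ((φ (a k ω)).ofLp ⬝ᵥ v - r k ω) ^ 2) - α * (v ⬝ᵥ v)) / (2 * σ ^ 2)

/-- The likelihood ratio integrated over `v`: the unnormalised method-of-mixtures
supermartingale. -/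
def mixture (σ α : ℝ) (φ : Act → EuclideanSpace ℝ (Fin d)) (θs : EuclideanSpace ℝ (Fin d))
    (a : ℕ → Ω → Act) (r : ℕ → Ω → ℝ) (t : ℕ) (ω : Ω) : ℝ≥0∞ :=
  ∫⁻ v : Fin d → ℝ, ENNReal.ofReal (Real.exp (logLikelihoodRatio σ α φ θs a r t v ω))

variable (σ α : ℝ) (φ : Act → EuclideanSpace ℝ (Fin d)) (θs : EuclideanSpace ℝ (Fin d))
  (a : ℕ → Ω → Act)

theorem measurable_logLikelihoodRatio [MeasurableSpace Act] (hφ : Measurable φ)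
    [MeasurableSpace Ω] {r : ℕ → Ω → ℝ} {t : ℕ} (ha : ∀ k < t, Measurable (a k))
    (hr : ∀ k < t, Measurable (r k)) :
    Measurable fun p : Ω × (Fin d → ℝ) => logLikelihoodRatio σ α φ θs a r t p.2 p.1 := by
  unfold logLikelihoodRatio
  refine (Measurable.sub (Finset.measurable_sum _ fun k hk => ?_) ?_).div_const _
  · have h1 : Measurable fun p : Ω × (Fin d → ℝ) => φ (a k p.1) :=
      hφ.comp ((ha k (Finset.mem_range.1 hk)).comp measurable_fst)
    have h2 : Measurable fun p : Ω × (Fin d → ℝ) => r k p.1 :=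
      (hr k (Finset.mem_range.1 hk)).comp measurable_fst
    clear ha hr
    have h3 : Measurable fun p : Ω × (Fin d → ℝ) => (φ (a k p.1)).ofLp ⬝ᵥ p.2 := by
      have h := (by fun_prop : Measurable fun x : EuclideanSpace ℝ (Fin d) => x.ofLp).comp h1
      exact Finset.measurable_sum _ fun i _ =>
        ((measurable_pi_apply i).comp h).mul ((measurable_pi_apply i).comp measurable_snd)
    have h4 : Measurable fun p : Ω × (Fin d → ℝ) => (inner ℝ (φ (a k p.1)) θs : ℝ) :=
      h1.inner_const
    exact ((h4.sub h2).pow_const 2).sub ((h3.sub h2).pow_const 2)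
  · unfold dotProduct
    fun_prop

theorem measurable_mixture [MeasurableSpace Act] (hφ : Measurable φ)
    [MeasurableSpace Ω] {r : ℕ → Ω → ℝ} {t : ℕ} (ha : ∀ k < t, Measurable (a k))
    (hr : ∀ k < t, Measurable (r k)) : Measurable (mixture σ α φ θs a r t) :=
  Measurable.lintegral_prod_right
    (measurable_logLikelihoodRatio σ α φ θs a hφ ha hr).exp.ennreal_ofReal

/-- With `u = φ(a_t)ᵀ v - φ(a_t)ᵀ θ*`, the new summand is `ε² - (u - ε)² = 2 u ε - u²`. Division by
`2 σ²` gives `l ε - l² σ² / 2` for `l = u / σ²`, the exponent compensated by sub-Gaussianity. -/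
theorem logLikelihoodRatio_succ (hσ : 0 < σ) (ε : ℕ → Ω → ℝ) (t : ℕ) (v : Fin d → ℝ) (ω : Ω) :
    logLikelihoodRatio σ α φ θs a (reward φ θs a ε) (t + 1) v ω =
      logLikelihoodRatio σ α φ θs a (reward φ θs a ε) t v ω +
        (((φ (a t ω)).ofLp ⬝ᵥ v - inner ℝ (φ (a t ω)) θs) / σ ^ 2 * ε t ω -
          (((φ (a t ω)).ofLp ⬝ᵥ v - inner ℝ (φ (a t ω)) θs) / σ ^ 2) ^ 2 * σ ^ 2 / 2) := by
  simp only [logLikelihoodRatio, Finset.sum_range_succ]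
  generalize ∑ k ∈ Finset.range t, ((inner ℝ (φ (a k ω)) θs - reward φ θs a ε k ω) ^ 2 -
    ((φ (a k ω)).ofLp ⬝ᵥ v - reward φ θs a ε k ω) ^ 2) = x
  simp only [reward]
  field_simp
  ring

theorem history_le [MeasurableSpace Act] [mΩ : MeasurableSpace Ω] {r : ℕ → Ω → ℝ}
    (ha : ∀ t, Measurable (a t)) (hr : ∀ t, Measurable (r t)) (t : ℕ) : history a r t ≤ mΩ :=
  sup_le (iSup_le fun k => sup_le (ha k).comap_le (hr k).comap_le) (ha t).comap_le

theorem comap_action_le_history [MeasurableSpace Act] (r : ℕ → Ω → ℝ) {k t : ℕ} (h : k ≤ t) :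
    MeasurableSpace.comap (a k) inferInstance ≤ history a r t := by
  rcases h.eq_or_lt with rfl | h
  · exact le_sup_right
  · exact (le_sup_left.trans (le_iSup (fun k : Fin t => MeasurableSpace.comap (a k) inferInstance ⊔
      MeasurableSpace.comap (r k) inferInstance) ⟨k, h⟩)).trans le_sup_left

theorem comap_reward_le_history [MeasurableSpace Act] (r : ℕ → Ω → ℝ) {k t : ℕ} (h : k < t) :
    MeasurableSpace.comap (r k) inferInstance ≤ history a r t :=
  (le_sup_right.trans (le_iSup (fun k : Fin t => MeasurableSpace.comap (a k) inferInstance ⊔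
    MeasurableSpace.comap (r k) inferInstance) ⟨k, h⟩)).trans le_sup_left

theorem history_mono [MeasurableSpace Act] (r : ℕ → Ω → ℝ) : Monotone (history a r) :=
  fun _ _ h => sup_le
    (iSup_le fun k => sup_le (comap_action_le_history a r (k.2.le.trans h))
      (comap_reward_le_history a r (k.2.trans_le h)))
    (comap_action_le_history a r h)

theorem measurable_reward [MeasurableSpace Act] [MeasurableSpace Ω] (hφ : Measurable φ)
    (ha : ∀ t, Measurable (a t)) {ε : ℕ → Ω → ℝ} (hε : ∀ t, Measurable (ε t)) (t : ℕ) :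
    Measurable (reward φ θs a ε t) :=
  (hφ.comp (ha t)).inner_const.add (hε t)

/-- Tonelli reduces the claim to a fixed `v`. The multiplier of the noise is a function of `a t`,
which the history contains. -/
theorem setLIntegral_mixture_succ_le [MeasurableSpace Act] [MeasurableSpace Ω] {μ : Measure Ω}
    [IsProbabilityMeasure μ] (hσ : 0 < σ) (hφ : Measurable φ) (ha : ∀ t, Measurable (a t))
    {ε : ℕ → Ω → ℝ} (hε : ∀ t, Measurable (ε t))
    (hnoise : SubGaussianNoise μ a (reward φ θs a ε) ε σ) (t : ℕ) {s : Set Ω}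
    (hs : MeasurableSet[history a (reward φ θs a ε) t] s) :
    ∫⁻ ω in s, mixture σ α φ θs a (reward φ θs a ε) (t + 1) ω ∂μ ≤
      ∫⁻ ω in s, mixture σ α φ θs a (reward φ θs a ε) t ω ∂μ := by
  set r := reward φ θs a ε with hr_def
  have hr := measurable_reward φ θs a hφ ha hε
  have hH := history_le a ha hr t
  have hmeas : ∀ t, Measurable fun p : Ω × (Fin d → ℝ) =>
      ENNReal.ofReal (Real.exp (logLikelihoodRatio σ α φ θs a r t p.2 p.1)) := fun t =>
    (measurable_logLikelihoodRatio σ α φ θs a hφ (fun k _ => ha k)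
      (fun k _ => hr k)).exp.ennreal_ofReal
  have hswap : ∀ t, ∫⁻ ω in s, mixture σ α φ θs a r t ω ∂μ = ∫⁻ v : Fin d → ℝ, ∫⁻ ω in s,
      ENNReal.ofReal (Real.exp (logLikelihoodRatio σ α φ θs a r t v ω)) ∂μ := fun t =>
    lintegral_lintegral_swap (hmeas t).aemeasurable
  rw [hswap, hswap]
  refine lintegral_mono fun v => ?_
  -- The event `s` is absorbed into the history-measurable weight `W`.
  rw [← lintegral_indicator (hH _ hs), ← lintegral_indicator (hH _ hs)]
  have hat : Measurable[history a r t] (a t) :=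
    measurable_iff_comap_le.2 (comap_action_le_history a r le_rfl)
  have hφa : Measurable[history a r t] fun ω => φ (a t ω) := hφ.comp hat
  have hl : Measurable[history a r t] fun ω =>
      ((φ (a t ω)).ofLp ⬝ᵥ v - inner ℝ (φ (a t ω)) θs) / σ ^ 2 := by
    have h : Measurable fun x : EuclideanSpace ℝ (Fin d) =>
        (x.ofLp ⬝ᵥ v - inner ℝ x θs) / σ ^ 2 := by
      have h1 : Measurable fun x : EuclideanSpace ℝ (Fin d) => (inner ℝ x θs : ℝ) :=
        measurable_id.inner_const
      unfold dotProduct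
      fun_prop
    exact h.comp hφa
  have hW : Measurable[history a r t] fun ω =>
      ENNReal.ofReal (Real.exp (logLikelihoodRatio σ α φ θs a r t v ω)) := by
    let _ : MeasurableSpace Ω := history a r t
    have h := measurable_logLikelihoodRatio σ α φ θs a hφ (r := r) (t := t)
      (fun k hk => measurable_iff_comap_le.2 (comap_action_le_history a r hk.le))
      (fun k hk => measurable_iff_comap_le.2 (comap_reward_le_history a r hk))
    exact (h.comp (measurable_id.prodMk measurable_const)).exp.ennreal_ofReal
  have key := lintegral_mul_exp_le_of_condExp_le hH (hε t)
    (fun l => ((hnoise t).2 l).1) (fun l => ((hnoise t).2 l).2) hl (hW.indicator hs)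
  refine le_trans (le_of_eq (lintegral_congr fun ω => ?_)) key
  by_cases hω : ω ∈ s
  · simp only [Set.indicator_of_mem hω]
    rw [← ENNReal.ofReal_mul (Real.exp_pos _).le, ← Real.exp_add, hr_def,
      logLikelihoodRatio_succ σ α φ θs a hσ]
  · simp [Set.indicator_of_notMem hω]

/-- Completing the square isolates a Gaussian in `v` centred at the ridge estimate; Woodbury turns
the remainder into the quadratic form of `R_MM²`. -/
theorem logLikelihoodRatio_eq (hα : 0 < α) (r : ℕ → Ω → ℝ) (t : ℕ) (v : Fin d → ℝ) (ω : Ω) :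
    logLikelihoodRatio σ α φ θs a r t v ω =
      (‖WithLp.toLp 2 (design φ a t ω *ᵥ θs.ofLp - rewardVec r t ω)‖ ^ 2 -
        rewardVec r t ω ⬝ᵥ ((1 + α⁻¹ • (design φ a t ω * (design φ a t ω)ᵀ))⁻¹ *ᵥ
          rewardVec r t ω)) / (2 * σ ^ 2) +
      -((v - ridge α (design φ a t ω) (rewardVec r t ω)) ⬝ᵥ (gram α (design φ a t ω) *ᵥ
        (v - ridge α (design φ a t ω) (rewardVec r t ω)))) / (2 * σ ^ 2) := by
  have h := regularized_sq_loss_eq hα (design φ a t ω) (rewardVec r t ω) v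
  have h1 : ∑ k ∈ Finset.range t, ((inner ℝ (φ (a k ω)) θs - r k ω) ^ 2 -
      ((φ (a k ω)).ofLp ⬝ᵥ v - r k ω) ^ 2) =
      (design φ a t ω *ᵥ θs.ofLp - rewardVec r t ω) ⬝ᵥ
        (design φ a t ω *ᵥ θs.ofLp - rewardVec r t ω) -
      (design φ a t ω *ᵥ v - rewardVec r t ω) ⬝ᵥ (design φ a t ω *ᵥ v - rewardVec r t ω) := by
    rw [Finset.sum_range, Finset.sum_sub_distrib]
    simp only [inner_eq_dotProduct, sq]
    rfl
  rw [logLikelihoodRatio, h1, ← add_div, norm_toLp_sq, inv_one_add_smul_mul_transpose hα,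
    Matrix.sub_mulVec, Matrix.one_mulVec, dotProduct_sub (rewardVec r t ω), ← Matrix.mulVec_mulVec,
    ← Matrix.mulVec_mulVec]
  congr 1
  linarith

theorem mixture_eq (hα : 0 < α) (r : ℕ → Ω → ℝ) (t : ℕ) (ω : Ω) :
    mixture σ α φ θs a r t ω =
      ENNReal.ofReal (Real.exp
        ((‖WithLp.toLp 2 (design φ a t ω *ᵥ θs.ofLp - rewardVec r t ω)‖ ^ 2 -
          rewardVec r t ω ⬝ᵥ ((1 + α⁻¹ • (design φ a t ω * (design φ a t ω)ᵀ))⁻¹ *ᵥ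
            rewardVec r t ω)) / (2 * σ ^ 2))) *
      ∫⁻ v : Fin d → ℝ, ENNReal.ofReal
        (Real.exp (-(v ⬝ᵥ (gram α (design φ a t ω) *ᵥ v)) / (2 * σ ^ 2))) := by
  simp_rw [mixture, logLikelihoodRatio_eq σ α φ θs a hα, Real.exp_add,
    ENNReal.ofReal_mul (Real.exp_pos _).le]
  -- Translation invariance of Lebesgue measure removes the ridge centre.
  rw [lintegral_const_mul' _ _ ENNReal.ofReal_ne_top,
    lintegral_sub_right_eq_self (fun v : Fin d → ℝ => ENNReal.ofReal
      (Real.exp (-(v ⬝ᵥ (gram α (design φ a t ω) *ᵥ v)) / (2 * σ ^ 2))))]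

/-- The mass of the unnormalised prior. -/
def priorMass (σ α : ℝ) (d : ℕ) : ℝ≥0∞ :=
  ∫⁻ v : Fin d → ℝ, ENNReal.ofReal (Real.exp (-(α * (v ⬝ᵥ v)) / (2 * σ ^ 2)))

theorem mixture_zero (r : ℕ → Ω → ℝ) (ω : Ω) :
    mixture σ α φ θs a r 0 ω = priorMass σ α d := by
  simp [mixture, logLikelihoodRatio, priorMass]

variable {σ α}

/-- The case `V = α 1` of the change of variables expresses the prior mass through the same standard
integral as the mixture. -/
theorem ofReal_mul_priorMass (hα : 0 < α) (d : ℕ) :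
    ENNReal.ofReal √(α ^ d) * priorMass σ α d =
      ∫⁻ v : Fin d → ℝ, ENNReal.ofReal (Real.exp (-(v ⬝ᵥ v) / (2 * σ ^ 2))) := by
  have h := ofReal_sqrt_det_mul_lintegral_exp
    ((Matrix.PosDef.one (n := Fin d) (R := ℝ)).smul hα) (2 * σ ^ 2)
  simpa [Matrix.smul_mulVec, Matrix.det_smul, priorMass] using h

theorem priorMass_ne_zero (hα : 0 < α) (d : ℕ) : priorMass σ α d ≠ 0 := by
  intro h
  have h1 := ofReal_mul_priorMass (σ := σ) hα d
  rw [h, mul_zero] at h1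
  exact lintegral_exp_neg_dotProduct_ne_zero _ h1.symm

theorem priorMass_ne_top (hσ : 0 < σ) (hα : 0 < α) (d : ℕ) : priorMass σ α d ≠ ∞ := by
  intro h
  have h1 := ofReal_mul_priorMass (σ := σ) hα d
  rw [h, ENNReal.mul_top (by simp [hα])] at h1
  exact lintegral_exp_neg_dotProduct_ne_top (by positivity) h1.symm

/-- Below the crossing level of the mixture supermartingale, `θ*` satisfies the defining
inequality of the confidence set. -/
theorem norm_sq_le_sqRadiusMM_of_mixture_le (hσ : 0 < σ) {c : ℝ} (hc : 0 < c) {δ : ℝ} (hδ : 0 < δ)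
    (r : ℕ → Ω → ℝ) (t : ℕ) (ω : Ω)
    (h : mixture σ (σ ^ 2 / c) φ θs a r t ω ≤ priorMass σ (σ ^ 2 / c) d / ENNReal.ofReal δ) :
    ‖WithLp.toLp 2 (design φ a t ω *ᵥ θs.ofLp - rewardVec r t ω)‖ ^ 2 ≤
      sqRadiusMM σ δ (rewardVec r t ω) 0 (scaledCov c φ a t ω) := by
  set α := σ ^ 2 / c with hα_def
  have hα : 0 < α := by positivity
  have hcov : (σ ^ 2)⁻¹ • scaledCov c φ a t ω =
      α⁻¹ • (design φ a t ω * (design φ a t ω)ᵀ) := by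
    rw [scaledCov, smul_smul, hα_def, inv_div]
    congr 1
    field_simp
  have hV := posDef_gram hα (design φ a t ω)
  rw [mixture_eq σ α φ θs a hα] at h
  set N := ‖WithLp.toLp 2 (design φ a t ω *ᵥ θs.ofLp - rewardVec r t ω)‖ ^ 2 with hN
  rw [sqRadiusMM, hcov, det_one_add_smul_mul_transpose hα, zero_sub, neg_dotProduct,
    Matrix.mulVec_neg, dotProduct_neg, neg_neg]
  set Q := rewardVec r t ω ⬝ᵥ ((1 + α⁻¹ • (design φ a t ω * (design φ a t ω)ᵀ))⁻¹ *ᵥ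
    rewardVec r t ω)
  set D := (gram α (design φ a t ω)).det with hD
  have hDpos : 0 < D := hV.det_pos
  have h1 := ofReal_sqrt_det_mul_lintegral_exp hV (2 * σ ^ 2)
  have h2 := ofReal_mul_priorMass (σ := σ) hα d
  set G := ∫⁻ v : Fin d → ℝ, ENNReal.ofReal (Real.exp (-(v ⬝ᵥ v) / (2 * σ ^ 2))) with hG
  have hG0 : G ≠ 0 := lintegral_exp_neg_dotProduct_ne_zero _
  have hGtop : G ≠ ∞ := lintegral_exp_neg_dotProduct_ne_top (by positivity)
  have hαd : 0 < α ^ d := by positivity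
  -- The mixture is `exp ((N - Q) / (2 σ²)) G / √D` and the prior mass is `G / √(α ^ d)`, so `G`
  -- cancels. Taking logarithms then yields the radius.
  have h3 : √(α ^ d) * δ * Real.exp ((N - Q) / (2 * σ ^ 2)) ≤ √D := by
    rw [← ENNReal.ofReal_le_ofReal_iff (Real.sqrt_nonneg _), ← ENNReal.mul_le_mul_iff_left hG0 hGtop]
    rw [ENNReal.le_div_iff_mul_le (Or.inl (by simpa using hδ)) (Or.inl ENNReal.ofReal_ne_top)] at h
    have h4 := mul_le_mul_right h (ENNReal.ofReal √(α ^ d) * ENNReal.ofReal √D)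
    rw [ENNReal.ofReal_mul (by positivity), ENNReal.ofReal_mul (by positivity)]
    calc _ = ENNReal.ofReal √(α ^ d) * ENNReal.ofReal √D *
          (ENNReal.ofReal (Real.exp ((N - Q) / (2 * σ ^ 2))) *
            (∫⁻ v : Fin d → ℝ, ENNReal.ofReal
              (Real.exp (-(v ⬝ᵥ (gram α (design φ a t ω) *ᵥ v)) / (2 * σ ^ 2)))) *
            ENNReal.ofReal δ) := by rw [← h1]; ring
      _ ≤ _ := h4
      _ = _ := by rw [← h2]; ring
  have h5 := Real.log_le_log (by positivity) h3
  rw [Real.log_mul (by positivity) (Real.exp_pos _).ne', Real.log_mul (by positivity) hδ.ne',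
    Real.log_exp, Real.log_sqrt hαd.le, Real.log_sqrt hDpos.le] at h5
  rw [Real.log_mul (by positivity) hDpos.ne', Real.log_inv, one_div, Real.log_inv]
  have h6 : (N - Q) / (2 * σ ^ 2) ≤ (Real.log D - Real.log (α ^ d)) / 2 - Real.log δ := by
    linarith
  rw [div_le_iff₀ (by positivity)] at h6
  linarith

/-- The confidence sets contain `θ*` simultaneously for all times up to `n` with probability at
least `1 - δ`. -/
theorem exists_confidence_event [MeasurableSpace Act] [MeasurableSpace Ω] (μ : Measure Ω)
    [IsProbabilityMeasure μ] (hσ : 0 < σ) {c : ℝ} (hc : 0 < c) {δ : ℝ} (hδ : 0 < δ)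
    (hφ : Measurable φ) (ha : ∀ t, Measurable (a t)) {ε : ℕ → Ω → ℝ} (hε : ∀ t, Measurable (ε t))
    (hnoise : SubGaussianNoise μ a (reward φ θs a ε) ε σ) (n : ℕ) :
    ∃ E : Set Ω, MeasurableSet E ∧ 1 - δ ≤ μ.real E ∧ ∀ ω ∈ E, ∀ t ≤ n,
      ‖WithLp.toLp 2 (design φ a t ω *ᵥ θs.ofLp - rewardVec (reward φ θs a ε) t ω)‖ ^ 2 ≤
        sqRadiusMM σ δ (rewardVec (reward φ θs a ε) t ω) 0 (scaledCov c φ a t ω) := by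
  set r := reward φ θs a ε with hr_def
  have hr := measurable_reward φ θs a hφ ha hε
  set α := σ ^ 2 / c with hα_def
  have hα : 0 < α := by positivity
  set Z := priorMass σ α d with hZ
  have hZ0 : Z ≠ 0 := priorMass_ne_zero hα d
  have hZtop : Z ≠ ∞ := priorMass_ne_top hσ hα d
  -- The mixture starts at the constant `Z`, so Ville's inequality at level `Z / δ` gives this
  -- crossing event measure at most `δ`.
  set F := {ω | ∃ t ≤ n, Z / ENNReal.ofReal δ ≤ mixture σ α φ θs a r t ω} with hF
  have hFm : MeasurableSet F := by
    have : F = ⋃ t ∈ Set.Iic n, {ω | Z / ENNReal.ofReal δ ≤ mixture σ α φ θs a r t ω} := by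
      ext; simp [hF]
    rw [this]
    exact MeasurableSet.biUnion (Set.to_countable _) fun t _ =>
      measurable_mixture σ α φ θs a hφ (fun k _ => ha k) (fun k _ => hr k) measurableSet_Ici
  have hville := meas_exists_le_mul_le_lintegral μ (history a r) (history_mono a r)
    (history_le a ha hr) (mixture σ α φ θs a r)
    (fun t => @measurable_mixture Ω Act d σ α φ θs a _ hφ (history a r t) r t
      (fun k hk => measurable_iff_comap_le.2 (comap_action_le_history a r hk.le))
      (fun k hk => measurable_iff_comap_le.2 (comap_reward_le_history a r hk)))
    (fun t s hs => setLIntegral_mixture_succ_le σ α φ θs a hσ hφ ha hε hnoise t hs)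
    (Z / ENNReal.ofReal δ) n
  simp_rw [mixture_zero, lintegral_const, measure_univ, mul_one] at hville
  rw [← hZ, ← hF, ENNReal.div_eq_inv_mul, mul_comm _ Z, mul_assoc] at hville
  have h1 : (ENNReal.ofReal δ)⁻¹ * μ F ≤ 1 := by
    rw [← ENNReal.mul_le_mul_iff_right hZ0 hZtop, mul_one]
    exact hville
  have h2 : μ F ≤ ENNReal.ofReal δ := by
    rw [← ENNReal.div_eq_inv_mul] at h1
    rwa [ENNReal.div_le_iff (by simpa using hδ) ENNReal.ofReal_ne_top, one_mul] at h1
  refine ⟨Fᶜ, hFm.compl, ?_, fun ω hω t ht => ?_⟩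
  · rw [probReal_compl_eq_one_sub hFm]
    have : μ.real F ≤ δ := ENNReal.toReal_le_of_le_ofReal hδ.le h2
    linarith
  · refine norm_sq_le_sqRadiusMM_of_mixture_le φ θs a hσ hc hδ r t ω ?_
    by_contra hlt
    exact hω ⟨t, ht, (not_le.1 hlt).le⟩

end Mixture

/-! ### Optimism, elliptical potential and the regret bound -/

section Regret

variable {t d : ℕ}

/-- The residual constraint plus `α` times the norm constraint bounds the regularised loss;
completing the square turns this into an ellipsoid around the ridge estimate. -/
theorem dotProduct_sub_ridge_le_sqRadiusAMM {σ δ B α : ℝ} (hα : 0 < α)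
    (Φ : Matrix (Fin t) (Fin d) ℝ) (r m : Fin t → ℝ) (S : Matrix (Fin t) (Fin t) ℝ)
    {θ : EuclideanSpace ℝ (Fin d)}
    (h1 : ‖WithLp.toLp 2 (Φ *ᵥ θ.ofLp - r)‖ ^ 2 ≤ sqRadiusMM σ δ r m S) (h2 : ‖θ‖ ≤ B) :
    (θ.ofLp - ridge α Φ r) ⬝ᵥ (gram α Φ *ᵥ (θ.ofLp - ridge α Φ r)) ≤
      sqRadiusAMM σ δ B α Φ r m S := by
  have h := regularized_sq_loss_eq hα Φ r θ.ofLp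
  rw [norm_toLp_sq] at h1
  have h3 : α * (θ.ofLp ⬝ᵥ θ.ofLp) ≤ α * B ^ 2 := by
    rw [← norm_sq_eq_dotProduct]
    gcongr
  rw [sqRadiusAMM]
  linarith

/-- The analytic confidence bounds enclose the predictions of every parameter in the confidence
set. -/
theorem abs_inner_sub_ridge_le {σ δ B α : ℝ} (hα : 0 < α)
    (Φ : Matrix (Fin t) (Fin d) ℝ) (r m : Fin t → ℝ) (S : Matrix (Fin t) (Fin t) ℝ)
    {θ : EuclideanSpace ℝ (Fin d)}
    (h1 : ‖WithLp.toLp 2 (Φ *ᵥ θ.ofLp - r)‖ ^ 2 ≤ sqRadiusMM σ δ r m S) (h2 : ‖θ‖ ≤ B)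
    (x : EuclideanSpace ℝ (Fin d)) :
    |inner ℝ x θ - x.ofLp ⬝ᵥ ridge α Φ r| ≤
      √(sqRadiusAMM σ δ B α Φ r m S) * √(x.ofLp ⬝ᵥ ((gram α Φ)⁻¹ *ᵥ x.ofLp)) := by
  rw [inner_eq_dotProduct, ← dotProduct_sub]
  exact abs_dotProduct_le_of_posDef (posDef_gram hα Φ) _ _
    (dotProduct_sub_ridge_le_sqRadiusAMM hα Φ r m S h1 h2)

theorem inner_le_ucb {σ δ B : ℝ} (Φ : Matrix (Fin t) (Fin d) ℝ) (r m : Fin t → ℝ)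
    (S : Matrix (Fin t) (Fin t) ℝ) {θ : EuclideanSpace ℝ (Fin d)}
    (hθ : θ ∈ confSet σ δ B Φ r m S) (x : EuclideanSpace ℝ (Fin d)) :
    inner ℝ x θ ≤ ucb σ δ B Φ r m S x := by
  -- The norm constraint makes the image bounded, without which `sSup` would be a default value.
  refine le_csSup ⟨‖x‖ * B, ?_⟩ (Set.mem_image_of_mem _ hθ)
  rintro _ ⟨θ', hθ', rfl⟩
  exact (real_inner_le_norm _ _).trans (mul_le_mul_of_nonneg_left hθ'.2 (norm_nonneg x))

theorem ucb_le_aucb {σ δ B α : ℝ} (hα : 0 < α) (Φ : Matrix (Fin t) (Fin d) ℝ) (r m : Fin t → ℝ)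
    (S : Matrix (Fin t) (Fin t) ℝ) (hne : (confSet σ δ B Φ r m S).Nonempty)
    (hR : 0 ≤ sqRadiusMM σ δ r m S) (x : EuclideanSpace ℝ (Fin d)) :
    ucb σ δ B Φ r m S x ≤ aucb σ δ B α Φ r m S x := by
  refine csSup_le (hne.image _) ?_
  rintro _ ⟨θ, hθ, rfl⟩
  -- Nonnegativity of `R_MM²` matters here: `√` of a negative number is `0` and could not be squared
  -- back.
  have h1 := (Real.le_sqrt (norm_nonneg _) hR).1 hθ.1
  have h := (abs_le.1 (abs_inner_sub_ridge_le hα Φ r m S h1 hθ.2 x)).2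
  rw [aucb]
  linarith

variable {Ω Act : Type*}

/-- By Woodbury, the quadratic form in `R_MM²` is `rᵀ r - rᵀ Φ V⁻¹ Φᵀ r`, exactly what `R_AMM²`
subtracts. Only the log-determinant, `α B²` and the confidence term remain. -/
theorem sqRadiusAMM_scaledCov_le {σ c δ L B : ℝ} (hσ : 0 < σ) (hc : 0 < c) (hd : 1 ≤ d)
    (φ : Act → EuclideanSpace ℝ (Fin d)) (a : ℕ → Ω → Act) (r : Fin t → ℝ) (ω : Ω)
    (hL : ∀ k, ‖φ (a k ω)‖ ≤ L) {T : ℕ} (hT : t ≤ T) :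
    sqRadiusAMM σ δ B (σ ^ 2 / c) (design φ a t ω) r 0 (scaledCov c φ a t ω) ≤
      σ ^ 2 * (d * Real.log (1 + c * L ^ 2 * T / (σ ^ 2 * d)) + B ^ 2 / c +
        2 * Real.log (1 / δ)) := by
  set α := σ ^ 2 / c with hα_def
  have hα : 0 < α := by positivity
  have hd' : (0 : ℝ) < d := by exact_mod_cast hd
  have hcov : (σ ^ 2)⁻¹ • scaledCov c φ a t ω =
      α⁻¹ • (design φ a t ω * (design φ a t ω)ᵀ) := by
    rw [scaledCov, smul_smul, hα_def, inv_div]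
    congr 1
    field_simp
  have hrow : ∀ k, design φ a t ω k ⬝ᵥ design φ a t ω k ≤ L ^ 2 := fun k => by
    have h := norm_sq_eq_dotProduct (φ (a k ω))
    calc design φ a t ω k ⬝ᵥ design φ a t ω k = ‖φ (a k ω)‖ ^ 2 := h.symm
      _ ≤ L ^ 2 := by gcongr; exact hL k
  have hdet := log_det_gram_le hα hd (design φ a t ω) hrow
  have hmono : Real.log (1 + L ^ 2 * t / (α * d)) ≤
      Real.log (1 + c * L ^ 2 * T / (σ ^ 2 * d)) := by
    have h : L ^ 2 * t / (α * d) = c * L ^ 2 * t / (σ ^ 2 * d) := by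
      rw [hα_def]; field_simp
    rw [h]
    gcongr
  rw [sqRadiusAMM, sqRadiusMM, hcov, det_one_add_smul_mul_transpose hα,
    inv_one_add_smul_mul_transpose hα, zero_sub, neg_dotProduct, Matrix.mulVec_neg,
    dotProduct_neg, neg_neg, Matrix.sub_mulVec, Matrix.one_mulVec, dotProduct_sub r,
    ← Matrix.mulVec_mulVec, ← Matrix.mulVec_mulVec]
  have h1 : σ ^ 2 * Real.log ((α ^ d)⁻¹ * (gram α (design φ a t ω)).det) ≤
      σ ^ 2 * (d * Real.log (1 + c * L ^ 2 * T / (σ ^ 2 * d))) := by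
    gcongr
    exact hdet.trans (by gcongr)
  have h2 : α * B ^ 2 = σ ^ 2 * (B ^ 2 / c) := by
    rw [hα_def]; ring
  linarith

/-- The elliptical potential identity. -/
theorem sum_log_one_add_eq {α : ℝ} (hα : 0 < α) (φ : Act → EuclideanSpace ℝ (Fin d))
    (a : ℕ → Ω → Act) (ω : Ω) (T : ℕ) :
    ∑ t ∈ Finset.range T, Real.log (1 + (φ (a t ω)).ofLp ⬝ᵥ
      ((gram α (design φ a t ω))⁻¹ *ᵥ (φ (a t ω)).ofLp)) =
      Real.log ((α ^ d)⁻¹ * (gram α (design φ a T ω)).det) := by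
  induction T with
  | zero =>
    have : gram α (design φ a 0 ω) = α • (1 : Matrix (Fin d) (Fin d) ℝ) := by
      ext i j
      simp [gram]
    rw [this, Matrix.det_smul]
    simp [hα.ne']
  | succ T ih =>
    have hV := posDef_gram hα (design φ a T ω)
    have hw : 0 ≤ (φ (a T ω)).ofLp ⬝ᵥ ((gram α (design φ a T ω))⁻¹ *ᵥ (φ (a T ω)).ofLp) := by
      simpa using hV.inv.posSemidef.dotProduct_mulVec_nonneg (φ (a T ω)).ofLp
    have hdet : (gram α (design φ a (T + 1) ω)).det = (gram α (design φ a T ω)).det *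
        (1 + (φ (a T ω)).ofLp ⬝ᵥ ((gram α (design φ a T ω))⁻¹ *ᵥ (φ (a T ω)).ofLp)) :=
      det_gram_succ hα (design φ a (T + 1) ω)
    have hpos := hV.det_pos
    rw [Finset.sum_range_succ, ih, hdet, ← mul_assoc,
      ← Real.log_mul (by positivity) (by positivity)]

theorem min_one_le_log_div_log_two {x : ℝ} (hx : 0 ≤ x) :
    min 1 x ≤ Real.log (1 + x) / Real.log 2 := by
  have h2 : 0 < Real.log 2 := Real.log_pos one_lt_two
  rw [le_div_iff₀ h2]
  rcases le_total 1 x with h | h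
  · rw [min_eq_left h, one_mul]
    exact Real.log_le_log two_pos (by linarith)
  · rw [min_eq_right h, ← Real.log_rpow two_pos]
    -- Bernoulli's inequality for an exponent `x` in `[0, 1]`: `2 ^ x ≤ 1 + x`.
    refine Real.log_le_log (by positivity) ?_
    have := rpow_one_add_le_one_add_mul_self (s := 1) (by norm_num) hx h
    rw [mul_one] at this
    norm_num at this
    exact this

/-- The sum of truncated widths is controlled by the elliptical potential. -/
theorem sum_min_one_sqrt_le (w : ℕ → ℝ) (hw : ∀ t, 0 ≤ w t) (T : ℕ) :
    ∑ t ∈ Finset.range T, min 1 √(w t) ≤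
      √(T * ((∑ t ∈ Finset.range T, Real.log (1 + w t)) / Real.log 2)) := by
  apply Real.le_sqrt_of_sq_le
  calc (∑ t ∈ Finset.range T, min 1 √(w t)) ^ 2
      ≤ T * ∑ t ∈ Finset.range T, min 1 √(w t) ^ 2 := by
        simpa using sq_sum_le_card_mul_sum_sq (s := Finset.range T) (f := fun t => min 1 √(w t))
    _ ≤ _ := by
        rw [Finset.sum_div]
        gcongr with t _
        refine le_trans ?_ (min_one_le_log_div_log_two (hw t))
        have h0 : 0 ≤ min 1 √(w t) := le_min zero_le_one (Real.sqrt_nonneg _)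
        refine le_min ?_ ?_
        · exact pow_le_one₀ h0 (min_le_left _ _)
        · exact (pow_le_pow_left₀ h0 (min_le_right _ _) 2).trans (Real.sq_sqrt (hw t)).le

/-- One-step regret of an optimistic choice. -/
theorem regret_le_of_optimism {σ δ B α C : ℝ} (hα : 0 < α)
    (φ : Act → EuclideanSpace ℝ (Fin d)) (θs : EuclideanSpace ℝ (Fin d))
    (A : ℕ → Ω → Set Act) (a : ℕ → Ω → Act) (t : ℕ) (ω : Ω) (r m : Fin t → ℝ)
    (S : Matrix (Fin t) (Fin t) ℝ) (hmem : a t ω ∈ A t ω)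
    (hrew : ∀ b ∈ A t ω, inner ℝ (φ b) θs ∈ Set.Icc (-C) C) (hparam : ‖θs‖ ≤ B)
    (hconf : ‖WithLp.toLp 2 (design φ a t ω *ᵥ θs.ofLp - r)‖ ^ 2 ≤ sqRadiusMM σ δ r m S)
    (halg : IsMaxOn (fun b => ucb σ δ B (design φ a t ω) r m S (φ b)) (A t ω) (a t ω) ∨
      IsMaxOn (fun b => aucb σ δ B α (design φ a t ω) r m S (φ b)) (A t ω) (a t ω)) :
    regret φ θs A a t ω ≤ 2 * C ∧
    regret φ θs A a t ω ≤ 2 * (√(sqRadiusAMM σ δ B α (design φ a t ω) r m S) *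
      √((φ (a t ω)).ofLp ⬝ᵥ ((gram α (design φ a t ω))⁻¹ *ᵥ (φ (a t ω)).ofLp))) := by
  have hne : ((fun b => (inner ℝ (φ b) θs : ℝ)) '' A t ω).Nonempty := ⟨_, _, hmem, rfl⟩
  have hR : 0 ≤ sqRadiusMM σ δ r m S := (sq_nonneg _).trans hconf
  have hθ : θs ∈ confSet σ δ B (design φ a t ω) r m S := ⟨Real.le_sqrt_of_sq_le hconf, hparam⟩
  have hopt : ∀ b ∈ A t ω,
      inner ℝ (φ b) θs ≤ aucb σ δ B α (design φ a t ω) r m S (φ (a t ω)) := by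
    intro b hb
    have h1 : ∀ x, inner ℝ x θs ≤ ucb σ δ B (design φ a t ω) r m S x :=
      inner_le_ucb (design φ a t ω) r m S hθ
    have h2 : ∀ x, ucb σ δ B (design φ a t ω) r m S x ≤ aucb σ δ B α (design φ a t ω) r m S x :=
      ucb_le_aucb hα (design φ a t ω) r m S ⟨_, hθ⟩ hR
    -- CMM-UCB is compared at the level of `ucb` and then relaxed to `aucb`; AMM-UCB is relaxed
    -- first. Both end at `aucb` of the played action.
    rcases halg with h | h
    · exact ((h1 _).trans (isMaxOn_iff.1 h b hb)).trans (h2 _)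
    · exact ((h1 _).trans (h2 _)).trans (isMaxOn_iff.1 h b hb)
  constructor
  · have h1 : sSup ((fun b => (inner ℝ (φ b) θs : ℝ)) '' A t ω) ≤ C := by
      refine csSup_le hne ?_
      rintro _ ⟨b, hb, rfl⟩
      exact (hrew b hb).2
    have h2 := (hrew _ hmem).1
    rw [regret]
    linarith
  · have h1 : sSup ((fun b => (inner ℝ (φ b) θs : ℝ)) '' A t ω) ≤
        aucb σ δ B α (design φ a t ω) r m S (φ (a t ω)) := by
      refine csSup_le hne ?_
      rintro _ ⟨b, hb, rfl⟩
      exact hopt b hb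
    -- The analytic bound exceeds the ridge prediction by one width, and the truth falls below it by
    -- at most one more: hence the factor 2.
    have h2 := (abs_le.1 (abs_inner_sub_ridge_le hα (design φ a t ω) r m S hconf hparam
      (φ (a t ω)))).1
    rw [aucb] at h1
    rw [regret]
    linarith

theorem cumRegret_le_regretBound {σ c L B C δ : ℝ} (hσ : 0 < σ) (hc : 0 < c) (hC : 0 < C)
    (hd : 1 ≤ d) (φ : Act → EuclideanSpace ℝ (Fin d)) (θs : EuclideanSpace ℝ (Fin d))
    (A : ℕ → Ω → Set Act) (a : ℕ → Ω → Act) (r : ℕ → Ω → ℝ) (T : ℕ) (ω : Ω)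
    (hL : ∀ k, ‖φ (a k ω)‖ ≤ L)
    (hreg : ∀ t < T, regret φ θs A a t ω ≤ 2 * C ∧
      regret φ θs A a t ω ≤ 2 * (√(sqRadiusAMM σ δ B (σ ^ 2 / c) (design φ a t ω)
        (rewardVec r t ω) 0 (scaledCov c φ a t ω)) * √((φ (a t ω)).ofLp ⬝ᵥ
          ((gram (σ ^ 2 / c) (design φ a t ω))⁻¹ *ᵥ (φ (a t ω)).ofLp)))) :
    cumRegret φ θs A a T ω ≤ regretBound σ c L B C δ d T := by
  set α := σ ^ 2 / c with hα_def
  have hα : 0 < α := by positivity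
  have h2 : 0 < Real.log 2 := Real.log_pos one_lt_two
  set w : ℕ → ℝ := fun t => (φ (a t ω)).ofLp ⬝ᵥ
    ((gram α (design φ a t ω))⁻¹ *ᵥ (φ (a t ω)).ofLp) with hw_def
  have hw : ∀ t, 0 ≤ w t := fun t => by
    simpa using (posDef_gram hα (design φ a t ω)).inv.posSemidef.dotProduct_mulVec_nonneg
      (φ (a t ω)).ofLp
  set ℓ := Real.log (1 + c * L ^ 2 * T / (σ ^ 2 * d)) with hℓ
  set β := σ * √(d * ℓ + B ^ 2 / c + 2 * Real.log (1 / δ)) with hβ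
  have hβ0 : 0 ≤ β := by positivity
  -- If the minimum is 1, the trivial bound `2 C` suffices; otherwise the width bound does. The
  -- maximum covers both cases.
  have hstep : ∀ t ∈ Finset.range T, regret φ θs A a t ω ≤ 2 * max C β * min 1 √(w t) := by
    intro t ht
    have htT := Finset.mem_range.1 ht
    obtain ⟨h1, h3⟩ := hreg t htT
    have hrad : √(sqRadiusAMM σ δ B α (design φ a t ω) (rewardVec r t ω) 0
        (scaledCov c φ a t ω)) ≤ β := by
      refine (Real.sqrt_le_sqrt
        (sqRadiusAMM_scaledCov_le hσ hc hd φ a (rewardVec r t ω) ω hL htT.le)).trans_eq ?_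
      rw [Real.sqrt_mul (sq_nonneg σ), Real.sqrt_sq hσ.le]
    have hmax : 0 ≤ max C β := hC.le.trans (le_max_left _ _)
    rcases min_choice 1 √(w t) with h | h <;> rw [h]
    · have := le_max_left C β
      linarith
    · have h4 : √(sqRadiusAMM σ δ B α (design φ a t ω) (rewardVec r t ω) 0
          (scaledCov c φ a t ω)) * √(w t) ≤ max C β * √(w t) := by
        gcongr
        exact hrad.trans (le_max_right _ _)
      linarith
  have hpot : ∑ t ∈ Finset.range T, Real.log (1 + w t) ≤ d * ℓ := by
    rw [sum_log_one_add_eq hα φ a ω T]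
    have h := log_det_gram_le (L := L) hα hd (design φ a T ω) fun k => by
      have h := norm_sq_eq_dotProduct (φ (a k ω))
      calc design φ a T ω k ⬝ᵥ design φ a T ω k = ‖φ (a k ω)‖ ^ 2 := h.symm
        _ ≤ L ^ 2 := by gcongr; exact hL k
    have h' : L ^ 2 * T / (α * d) = c * L ^ 2 * T / (σ ^ 2 * d) := by
      have hd' : (0 : ℝ) < d := by exact_mod_cast hd
      rw [hα_def]; field_simp
    rwa [h'] at h
  have hmax : 0 ≤ max C β := hC.le.trans (le_max_left _ _)
  calc cumRegret φ θs A a T ω ≤ ∑ t ∈ Finset.range T, 2 * max C β * min 1 √(w t) :=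
        Finset.sum_le_sum hstep
    _ = 2 * max C β * ∑ t ∈ Finset.range T, min 1 √(w t) := by rw [Finset.mul_sum]
    _ ≤ 2 * max C β * √(T * (d * ℓ / Real.log 2)) := by
        gcongr
        refine (sum_min_one_sqrt_le w hw T).trans ?_
        gcongr
    _ = regretBound σ c L B C δ d T := by
        have h : (T : ℝ) * (d * ℓ / Real.log 2) = d * T * ℓ / Real.log 2 := by ring
        rw [regretBound, h, Real.sqrt_div' _ h2.le]
        ring

/-- The regret bound grows like `d √T log T`. -/
theorem exists_regretBound_le {σ c : ℝ} (hσ : 0 < σ) (hc : 0 < c) (L B : ℝ) {C δ : ℝ} (hC : 0 < C)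
    (hδ0 : 0 < δ) (hδ1 : δ ≤ 1) :
    ∃ K : ℝ, ∀ n T : ℕ, 1 ≤ n → 2 ≤ T →
      regretBound σ c L B C δ n T ≤ K * (n * √(T : ℝ) * Real.log T) := by
  have h2 : 0 < Real.log 2 := Real.log_pos one_lt_two
  set κ := c * L ^ 2 / σ ^ 2 with hκ
  have hκ0 : 0 ≤ κ := by positivity
  -- Since `ln T ≥ ln 2`, the constant `ln (1 + κ)` is at most `ln (1 + κ) / ln 2 * ln T`; the extra
  -- 1 accounts for `ln T` itself. Dropping the division by `n` keeps `M` independent of the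
  -- dimension.
  set M := Real.log (1 + κ) / Real.log 2 + 1 with hM
  have hκlog : 0 ≤ Real.log (1 + κ) := Real.log_nonneg (by linarith)
  have hM0 : 0 < M := by positivity
  set D := B ^ 2 / c + 2 * Real.log (1 / δ) with hD
  have hδlog : 0 ≤ Real.log (1 / δ) := Real.log_nonneg (by rw [le_div_iff₀ hδ0]; linarith)
  have hD0 : 0 ≤ D := by positivity
  -- In the same way `n ln T ≥ ln 2` absorbs `C` and `D` into multiples of `√(n ln T)` and `n ln T`.
  set N := C / √(Real.log 2) + σ * √(M + D / Real.log 2) with hN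
  refine ⟨2 / √(Real.log 2) * N * √M, fun n T hn hT => ?_⟩
  have hn' : (1 : ℝ) ≤ n := by exact_mod_cast hn
  have hT' : (2 : ℝ) ≤ T := by exact_mod_cast hT
  have hlogT : Real.log 2 ≤ Real.log T := Real.log_le_log two_pos hT'
  have hlog0 : 0 < Real.log T := h2.trans_le hlogT
  set ℓ := Real.log (1 + c * L ^ 2 * T / (σ ^ 2 * n)) with hℓ
  have hℓ0 : 0 ≤ ℓ := Real.log_nonneg (le_add_of_nonneg_right (by positivity))
  have hℓM : ℓ ≤ M * Real.log T := by
    have h1 : 1 + c * L ^ 2 * T / (σ ^ 2 * n) ≤ (1 + κ) * T := by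
      have : c * L ^ 2 * T / (σ ^ 2 * n) ≤ κ * T := by
        calc c * L ^ 2 * T / (σ ^ 2 * n) = κ * T / n := by rw [hκ]; field_simp
          _ ≤ κ * T := div_le_self (by positivity) hn'
      linarith
    have h3 : ℓ ≤ Real.log (1 + κ) + Real.log T := by
      rw [← Real.log_mul (by positivity) (by positivity)]
      exact Real.log_le_log (by positivity) h1
    have h4 : Real.log (1 + κ) ≤ Real.log (1 + κ) / Real.log 2 * Real.log T := by
      rw [div_mul_eq_mul_div, le_div_iff₀ h2]
      gcongr
    rw [hM, add_mul, one_mul]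
    linarith
  have hs0 : 0 < √(n * Real.log T) := Real.sqrt_pos.2 (by positivity)
  have hnT : Real.log 2 ≤ n * Real.log T := hlogT.trans (le_mul_of_one_le_left hlog0.le hn')
  have hmax : max C (σ * √(n * ℓ + B ^ 2 / c + 2 * Real.log (1 / δ))) ≤
      N * √(n * Real.log T) := by
    rw [hN, add_mul]
    have hA : C ≤ C / √(Real.log 2) * √(n * Real.log T) := by
      rw [div_mul_eq_mul_div, le_div_iff₀ (Real.sqrt_pos.2 h2)]
      gcongr
    have hA' : σ * √(n * ℓ + B ^ 2 / c + 2 * Real.log (1 / δ)) ≤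
        σ * √(M + D / Real.log 2) * √(n * Real.log T) := by
      rw [mul_assoc, ← Real.sqrt_mul (by positivity)]
      gcongr
      have h5 : n * ℓ ≤ n * (M * Real.log T) := by gcongr
      have h6 : D ≤ D / Real.log 2 * (n * Real.log T) := by
        rw [div_mul_eq_mul_div, le_div_iff₀ h2]
        gcongr
      linarith
    refine max_le ?_ ?_
    · exact le_add_of_le_of_nonneg hA (by positivity)
    · exact le_add_of_nonneg_of_le (by positivity) hA'
  have hroot : √(n * T * ℓ) ≤ √M * (√(n * Real.log T) * √T) := by
    rw [← Real.sqrt_mul (by positivity), ← Real.sqrt_mul hM0.le]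
    refine Real.sqrt_le_sqrt ?_
    have : n * T * ℓ ≤ n * T * (M * Real.log T) := by gcongr
    linarith
  calc regretBound σ c L B C δ n T
      = 2 / √(Real.log 2) * max C (σ * √(n * ℓ + B ^ 2 / c + 2 * Real.log (1 / δ))) *
          √(n * T * ℓ) := rfl
    _ ≤ 2 / √(Real.log 2) * (N * √(n * Real.log T)) *
          (√M * (√(n * Real.log T) * √T)) := by gcongr
    _ = 2 / √(Real.log 2) * N * √M * ((√(n * Real.log T) * √(n * Real.log T)) * √T) := by ring
    _ = 2 / √(Real.log 2) * N * √M * (n * √(T : ℝ) * Real.log T) := by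
        rw [Real.mul_self_sqrt (by positivity)]
        ring

end Regret

end LinBandit

end

/-! ### The confidence event combined with the pathwise regret bound -/

theorem theorem4 (σ c L B C δ : ℝ) (hσ : 0 < σ) (hc : 0 < c) (hL : 0 < L) (hB : 0 < B)
    (hC : 0 < C) (hδ0 : 0 < δ) (hδ1 : δ ≤ 1)
    {d : ℕ} (hd : 1 ≤ d)
    {Ω : Type*} [MeasurableSpace Ω] (μ : Measure Ω) [IsProbabilityMeasure μ]
    {Act : Type*} [MeasurableSpace Act]
    (φ : Act → EuclideanSpace ℝ (Fin d)) (hφ : Measurable φ)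
    (θs : EuclideanSpace ℝ (Fin d))
    (A : ℕ → Ω → Set Act)
    (a : ℕ → Ω → Act) (ha : ∀ t, Measurable (a t))
    (ε : ℕ → Ω → ℝ) (hε : ∀ t, Measurable (ε t))
    (hnoise : LinBandit.SubGaussianNoise μ a (LinBandit.reward φ θs a ε) ε σ)
    (hparam : ‖θs‖ ≤ B)
    (hfeat : ∀ t ω, ∀ b ∈ A t ω, ‖φ b‖ ≤ L)
    (hrew : ∀ t ω, ∀ b ∈ A t ω, inner ℝ (φ b) θs ∈ Set.Icc (-C) C)
    (halg : LinBandit.IsCMMUCB σ δ B (fun _ _ => 0) (LinBandit.scaledCov c φ a) φ A a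
          (LinBandit.reward φ θs a ε) ∨
        LinBandit.IsAMMUCB σ δ B (σ ^ 2 / c) (fun _ _ => 0) (LinBandit.scaledCov c φ a) φ A a
          (LinBandit.reward φ θs a ε)) :
    (∀ T : ℕ, 1 ≤ T → ∃ E : Set Ω, MeasurableSet E ∧ 1 - δ ≤ μ.real E ∧
      ∀ ω ∈ E, LinBandit.cumRegret φ θs A a T ω ≤ LinBandit.regretBound σ c L B C δ d T) ∧
    (∃ K : ℝ, ∀ n T : ℕ, 1 ≤ n → 2 ≤ T →
      LinBandit.regretBound σ c L B C δ n T ≤ K * (n * √(T : ℝ) * Real.log T)) := by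
  refine ⟨fun T _ => ?_, LinBandit.exists_regretBound_le hσ hc L B hC hδ0 hδ1⟩
  obtain ⟨E, hE, hprob, hconf⟩ :=
    LinBandit.exists_confidence_event φ θs a μ hσ hc hδ0 hφ ha hε hnoise T
  have hmem : ∀ t ω, a t ω ∈ A t ω := fun t ω =>
    halg.elim (fun h => (h t ω).1) fun h => (h t ω).1
  refine ⟨E, hE, hprob, fun ω hω => ?_⟩
  refine LinBandit.cumRegret_le_regretBound hσ hc hC hd φ θs A a
    (LinBandit.reward φ θs a ε) T ω (fun k => hfeat k ω _ (hmem k ω)) fun t ht => ?_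
  exact LinBandit.regret_le_of_optimism (by positivity) φ θs A a t ω _ _ _ (hmem t ω) (hrew t ω)
    hparam (hconf ω hω t ht.le) (halg.imp (fun h => (h t ω).2) fun h => (h t ω).2)
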